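/- Let $\mathrm{Vir}=\bigoplus_{n\in\mathbb Z}\mathbb C L_n\oplus\mathbb C C$ be the Virasoro algebra, with $C$ central and $[L_m,L_n]=(m-n)L_{m+n}+\frac{m^3-m}{12}\delta_{m+n,0}C$. For $c\in\mathbb C$ let $M(c,0)=U(\mathrm{Vir})\otimes_{U(\mathfrak b)}\mathbb C$ be the Verma module of highest weight $(c,0)$, where $\mathfrak b$ is spanned by $C$ and the $L_n$ with $n\ge 0$, and $C$ acts on $\mathbb C$ by $c$ and $L_n$ by $0$ for $n\ge 0$; let $v_0$ be its highest weight vector. Put $V=\overline{M(c,0)}=M(c,0)/U(\mathrm{Vir})L_{-1}v_0$ and write $v_0$ and $L_n$ also for the image of $v_0$ in $V$ and for the action of $L_n$ on $V$. Then for every $c\in\mathbb C$ there is a vertex algebra structure on $V$, that is, a linear map $a\mapsto Y(a,z)=\sum_{n\in\mathbb Z}a_{(n)}z^{-n-1}$ from $V$ to the fields on $V$, which together with the vacuum vector $|0\rangle=v_0$ and the translation operator $T=L_{-1}$ satisfies $[T,Y(a,z)]=\partial Y(a,z)$, $(z-w)^N[Y(a,z),Y(b,w)]=0$ for $N\gg0$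 (depending on $a,b$), $T|0\rangle=0$, $Y(|0\rangle,z)=\mathrm{id}_V$ and $Y(a,z)|0\rangle|_{z=0}=a$, with the following properties. 1. The field of $\nu=L_{-2}v_0$ is $Y(\nu,z)=L(z)=\sum_{n\in\mathbb Z}L_nz^{-n-2}$, and $\nu$ is a conformal vector of central charge $c$: $L(z)L(w)\sim\frac{c/2\,\mathrm{id}_V}{(z-w)^4}+\frac{2L(w)}{(z-w)^2}+\frac{\partial L(w)}{z-w}$, $L_{-1}=T$, and $L_0$ is diagonalizable on $V$. 2. $V$ is a vertex operator algebra of CFT type: with $V_n=\ker(L_0-n\,\mathrm{id}_V)$ one has $V=\bigoplus_{n\in\mathbb Z}V_n$, $\dim V_n<\infty$ for all $n$, $V_n=0$ for $n<0$, and $V_0=\mathbb C|0\rangle$ with $|0\rangle\neq 0$. 3. $V$ is strongly generated by the field $L(z)=\sum_n L_{(n)}z^{-n-1}$ (so $L_{(n)}=L_{n-1}$): the vectors $L_{(j_1)}\cdots L_{(j_k)}|0\rangle$ with $k\ge0$ and all $j_i<0$ span $V$. -/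

import Mathlib

noncomputable section

/-! ### The Virasoro algebra -/

/-- The underlying vector space `⨁ n : ℤ, ℂ Lₙ ⊕ ℂ C` of the Virasoro algebra. -/
@[ext]
structure Virasoro where
  /-- the coefficients of the `Lₙ` -/
  witt : ℤ →₀ ℂ
  /-- the coefficient of `C` -/
  central : ℂ

namespace Virasoro

/-- The identification with `⨁ n : ℤ, ℂ ⊕ ℂ` through which the vector space structure is defined. -/
def equivProd : Virasoro ≃ (ℤ →₀ ℂ) × ℂ where
  toFun x := (x.witt, x.central)
  invFun p := ⟨p.1, p.2⟩
  left_inv _ := rfl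
  right_inv _ := rfl

instance : AddCommGroup Virasoro := equivProd.addCommGroup

instance : Module ℂ Virasoro := equivProd.module ℂ

@[simp] theorem witt_zero : (0 : Virasoro).witt = 0 := rfl
@[simp] theorem central_zero : (0 : Virasoro).central = 0 := rfl
@[simp] theorem witt_add (x y : Virasoro) : (x + y).witt = x.witt + y.witt := rfl
@[simp] theorem central_add (x y : Virasoro) : (x + y).central = x.central + y.central := rfl
@[simp] theorem witt_smul (r : ℂ) (x : Virasoro) : (r • x).witt = r • x.witt := rfl
@[simp] theorem central_smul (r : ℂ) (x : Virasoro) : (r • x).central = r * x.central := rfl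

/-- The basis vector `Lₙ`. -/
def L (n : ℤ) : Virasoro := ⟨Finsupp.single n 1, 0⟩

/-- The central element `C`. -/
def C : Virasoro := ⟨0, 1⟩

/-- The bracket `[Lₘ, Lₙ] = (m - n) Lₘ₊ₙ + δ_{m+n,0} (m³ - m)/12 C` on basis vectors. -/
def basisBracket (m n : ℤ) : Virasoro :=
  ((m : ℂ) - n) • L (m + n) + (if m + n = 0 then ((m : ℂ) ^ 3 - m) / 12 else 0) • C

/-- The bilinear extension of `basisBracket`. -/
def wittBracket : (ℤ →₀ ℂ) →ₗ[ℂ] (ℤ →₀ ℂ) →ₗ[ℂ] Virasoro :=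
  Finsupp.lift _ ℂ ℤ fun m => Finsupp.lift _ ℂ ℤ fun n => basisBracket m n

theorem wittBracket_single (m n : ℤ) (a b : ℂ) :
    wittBracket (Finsupp.single m a) (Finsupp.single n b) = (a * b) • basisBracket m n := by
  simp [wittBracket, mul_smul, smul_comm a b]

theorem wittBracket_skew (x y : ℤ →₀ ℂ) : wittBracket x y = -wittBracket y x := by
  suffices h : wittBracket = -wittBracket.flip by
    conv_lhs => rw [h]
    rfl
  ext m n : 4
  simp only [LinearMap.comp_apply, LinearMap.neg_apply, LinearMap.flip_apply,
    Finsupp.lsingle_apply, wittBracket_single, one_mul, one_smul, basisBracket]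
  rw [add_comm n m, eq_neg_iff_add_eq_zero]
  by_cases h : m + n = 0
  · obtain rfl : n = -m := by omega
    ext
    · simp; ring
    · simp; ring
  · simp only [h, if_false]
    ext
    · simp; ring
    · simp [L]

instance : Bracket Virasoro Virasoro := ⟨fun x y => wittBracket x.witt y.witt⟩

theorem lie_def (x y : Virasoro) : ⁅x, y⁆ = wittBracket x.witt y.witt := rfl

theorem leibniz_aux (x y z : ℤ →₀ ℂ) :
    wittBracket x (wittBracket y z).witt =
      wittBracket (wittBracket x y).witt z + wittBracket y (wittBracket x z).witt := by
  induction x using Finsupp.induction_linear with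
  | zero => simp
  | add x₁ x₂ h₁ h₂ => simp only [map_add, LinearMap.add_apply, witt_add, h₁, h₂]; abel
  | single m a =>
  induction y using Finsupp.induction_linear with
  | zero => simp
  | add x₁ x₂ h₁ h₂ => simp only [map_add, LinearMap.add_apply, witt_add, h₁, h₂]; abel
  | single n b =>
  induction z using Finsupp.induction_linear with
  | zero => simp
  | add x₁ x₂ h₁ h₂ => simp only [map_add, witt_add, h₁, h₂]; abel
  | single k d =>
  simp only [wittBracket_single, witt_smul, witt_add, basisBracket, L, C, smul_zero, add_zero,
    Finsupp.smul_single, smul_eq_mul, mul_one]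
  rw [show m + (n + k) = m + n + k by ring, show n + (m + k) = m + n + k by ring]
  by_cases h : m + n + k = 0
  · obtain rfl : k = -m - n := by omega
    ext
    · simp [Finsupp.single_apply]
      split_ifs <;> ring
    · simp
      ring
  · simp only [h, if_false]
    ext
    · simp [Finsupp.single_apply]
      split_ifs <;> ring
    · simp

instance : LieRing Virasoro where
  add_lie x y z := by simp [lie_def]
  lie_add x y z := by simp [lie_def]
  lie_self x := by
    have h := wittBracket_skew x.witt x.witt
    rw [lie_def]
    have h2 : (2 : ℂ) • wittBracket x.witt x.witt = 0 := by
      rw [two_smul]; nth_rewrite 1 [h]; simp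
    exact (smul_eq_zero.mp h2).resolve_left two_ne_zero
  leibniz_lie x y z := by simpa only [lie_def] using leibniz_aux x.witt y.witt z.witt

instance : LieAlgebra ℂ Virasoro where
  lie_smul r x y := by simp [lie_def]

theorem lie_L_L (m n : ℤ) :
    ⁅L m, L n⁆ =
      ((m : ℂ) - n) • L (m + n) + (if m + n = 0 then ((m : ℂ) ^ 3 - m) / 12 else 0) • C := by
  simp only [lie_def, L, wittBracket_single, one_mul, one_smul]
  rfl

theorem lie_C (x : Virasoro) : ⁅x, C⁆ = 0 := by
  simp [lie_def, C]

/-- The universal enveloping algebra `U(Vir)`. -/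
abbrev U : Type := UniversalEnvelopingAlgebra ℂ Virasoro

/-- The inclusion `Vir → U(Vir)`. -/
abbrev toU (x : Virasoro) : U := UniversalEnvelopingAlgebra.ι ℂ x

/-! ### Verma modules and the vacuum module -/

/-- The left ideal of `U(Vir)` generated by `Lₙ` (`n ≥ 1`), `L₀ - h` and `C - c`. -/
def vermaIdeal (c h : ℂ) : Submodule U U :=
  Submodule.span U
    ({x | ∃ n : ℤ, 1 ≤ n ∧ x = toU (L n)} ∪
      {toU (L 0) - algebraMap ℂ U h, toU C - algebraMap ℂ U c})

/-- The Verma module `M(c, h) = U(Vir) ⊗_{U(𝔟)} ℂ`, where `𝔟` is spanned by `C` and the `Lₙ` with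
`n ≥ 0`, and acts on `ℂ` by `C ↦ c`, `L₀ ↦ h`, `Lₙ ↦ 0` (`n ≥ 1`). A module induced from a
one-dimensional module with character `χ` is the quotient of `U(Vir)` by the left ideal generated
by the `x - χ(x)`, `x ∈ 𝔟`. -/
abbrev Verma (c h : ℂ) : Type := U ⧸ vermaIdeal c h

/-- The highest weight vector `v₀` of `M(c, h)`. -/
def Verma.v₀ (c h : ℂ) : Verma c h := Submodule.Quotient.mk 1

/-- The quotient `M(c, 0) / U(Vir) L₋₁ v₀`. -/
abbrev VacuumModule (c : ℂ) : Type :=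
  Verma c 0 ⧸ Submodule.span U {toU (L (-1)) • Verma.v₀ c 0}

/-- The image of `v₀` in `M(c, 0) / U(Vir) L₋₁ v₀`. -/
def VacuumModule.v₀ (c : ℂ) : VacuumModule c := Submodule.Quotient.mk (Verma.v₀ c 0)

/-- The action of `Lₙ` on `M(c, 0) / U(Vir) L₋₁ v₀`. -/
def VacuumModule.mode (c : ℂ) (n : ℤ) : Module.End ℂ (VacuumModule c) :=
  Algebra.lsmul ℂ ℂ (VacuumModule c) (toU (L n))

/-- The vector `L₋₂ v₀`. -/
def VacuumModule.ν (c : ℂ) : VacuumModule c := VacuumModule.mode c (-2) (VacuumModule.v₀ c)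

end Virasoro

/-! ### Formal distributions

A formal distribution `a(z) = ∑ₙ a₍ₙ₎ z⁻ⁿ⁻¹` is given by its family of modes `n ↦ a₍ₙ₎`, and
`∑ₘₙ f₍ₘ,ₙ₎ z⁻ᵐ⁻¹ w⁻ⁿ⁻¹` by the family `f`. -/

namespace FormalDistribution

variable {E : Type*} [Ring E]

/-- The derivative `∂a(z)`. -/
def deriv (a : ℤ → E) : ℤ → E := fun n => (-n) • a (n - 1)

/-- The constant distribution with value `e`. -/
def const (e : E) : ℤ → E := fun n => if n = -1 then e else 0

/-- The commutator `[a(z), b(w)]`. -/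
def commutator (a b : ℤ → E) : ℤ → ℤ → E := fun m n => a m * b n - b n * a m

/-- Multiplication of a formal distribution in `z, w` by `z - w`. -/
def mulSub (f : ℤ → ℤ → E) : ℤ → ℤ → E := fun m n => f (m + 1) n - f m (n + 1)

/-- Locality: `(z - w)ᴺ [a(z), b(w)] = 0` for some `N`. -/
def MutuallyLocal (a b : ℤ → E) : Prop := ∃ N : ℕ, mulSub^[N] (commutator a b) = 0

/-- The normally ordered product `:a(z)b(w): = a(z)₊ b(w) + b(w) a(z)₋`, where `a(z)₊` consists of
the terms of `a(z)` with modes `m < 0`, and `a(z)₋` of those with `m ≥ 0`. -/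
def normalOrder (a b : ℤ → E) : ℤ → ℤ → E := fun m n => if m < 0 then a m * b n else b n * a m

/-- The product of `g(w)` with the expansion
`(z - w)^{-j-1} = ∑_{m ≥ 0} (m choose j) z⁻ᵐ⁻¹ wᵐ⁻ʲ` in the domain `|z| > |w|`. -/
def poleZW (j : ℕ) (g : ℤ → E) : ℤ → ℤ → E :=
  fun m n => if 0 ≤ m then Ring.choose m j • g (m + n - j) else 0

/-- The product of `g(w)` with the expansion
`(z - w)^{-j-1} = -∑_{m < 0} (m choose j) z⁻ᵐ⁻¹ wᵐ⁻ʲ` in the domain `|w| > |z|`. -/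
def poleWZ (j : ℕ) (g : ℤ → E) : ℤ → ℤ → E :=
  fun m n => if m < 0 then -(Ring.choose m j • g (m + n - j)) else 0

/-- The operator product expansion `a(z) b(w) ∼ ∑_{j < N} gʲ(w) / (z - w)^{j+1}`, that is,
`a(z) b(w) = ∑ gʲ(w) (z - w)^{-j-1} + :a(z)b(w):` with the expansion in `|z| > |w|`, and
`b(w) a(z) = ∑ gʲ(w) (z - w)^{-j-1} + :a(z)b(w):` with the expansion in `|w| > |z|`. -/
def HasOPE (a b : ℤ → E) {N : ℕ} (g : Fin N → ℤ → E) : Prop :=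
  (∀ m n, a m * b n = ∑ j : Fin N, poleZW j (g j) m n + normalOrder a b m n) ∧
    ∀ m n, b n * a m = ∑ j : Fin N, poleWZ j (g j) m n + normalOrder a b m n

end FormalDistribution

/-- A field `L(z)` is a Virasoro field with central charge `c` if
`L(z) L(w) ∼ (c/2) id / (z-w)⁴ + 2 L(w) / (z-w)² + ∂L(w) / (z-w)`. -/
def IsVirasoroField {V : Type*} [AddCommGroup V] [Module ℂ V] (c : ℂ) (F : VertexOperator ℂ V) :
    Prop :=
  FormalDistribution.HasOPE F.ncoeff F.ncoeff
    ![FormalDistribution.deriv F.ncoeff, (2 : ℂ) • F.ncoeff, 0,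
      FormalDistribution.const ((c / 2) • (1 : Module.End ℂ V))]

/-! ### Vertex algebras -/

/-- A vertex algebra structure on a complex vector space `V`. Mathlib's `VertexOperator ℂ V`, the
linear maps from `V` to `V`-valued Laurent series, is the space of fields on `V`, and
`(Y a).ncoeff n` is the mode `a₍ₙ₎`. -/
structure VertexAlgebra (V : Type*) [AddCommGroup V] [Module ℂ V] where
  /-- the vacuum vector -/
  vac : V
  /-- the infinitesimal translation operator -/
  T : Module.End ℂ V
  /-- the state-field correspondence -/
  Y : V →ₗ[ℂ] VertexOperator ℂ V
  /-- `[T, Y(a, z)] = ∂Y(a, z)` -/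
  translation : ∀ a n,
    T * (Y a).ncoeff n - (Y a).ncoeff n * T = FormalDistribution.deriv (Y a).ncoeff n
  locality : ∀ a b, FormalDistribution.MutuallyLocal (Y a).ncoeff (Y b).ncoeff
  T_vac : T vac = 0
  /-- `Y(|0⟩, z) = id` -/
  Y_vac : (Y vac).ncoeff = FormalDistribution.const 1
  /-- `Y(a, z)|0⟩` has no negative powers of `z` -/
  ncoeff_vac : ∀ a (n : ℤ), 0 ≤ n → (Y a).ncoeff n vac = 0
  /-- `Y(a, z)|0⟩` has the value `a` at `z = 0` -/
  ncoeff_neg_one_vac : ∀ a, (Y a).ncoeff (-1) vac = a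

namespace VertexAlgebra

variable {V : Type*} [AddCommGroup V] [Module ℂ V] (A : VertexAlgebra V)

/-- The modes `Lₙ = ν₍ₙ₊₁₎` in `Y(ν, z) = ∑ₙ Lₙ z⁻ⁿ⁻²`. -/
def Lmode (ν : V) (n : ℤ) : Module.End ℂ V := (A.Y ν).ncoeff (n + 1)

/-- `ν` is a conformal vector with central charge `c`. -/
structure IsConformalVector (c : ℂ) (ν : V) : Prop where
  virasoro : IsVirasoroField c (A.Y ν)
  L_neg_one : A.Lmode ν (-1) = A.T
  /-- `L₀` is diagonalizable -/
  diagonalizable : ⨆ μ : ℂ, (A.Lmode ν 0).eigenspace μ = ⊤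

/-- The homogeneous subspace `Vₙ = ker (L₀ - n)`. -/
def homogeneous (ν : V) (n : ℤ) : Submodule ℂ V := (A.Lmode ν 0).eigenspace (n : ℂ)

/-- The vertex algebra with the conformal vector `ν` of central charge `c` is a vertex operator
algebra. -/
structure IsVertexOperatorAlgebra (c : ℂ) (ν : V) : Prop extends A.IsConformalVector c ν where
  isInternal : DirectSum.IsInternal (A.homogeneous ν)
  bounded_below : ∃ N : ℤ, ∀ n < N, A.homogeneous ν n = ⊥
  finite : ∀ n, Module.Finite ℂ (A.homogeneous ν n)

/-- The vertex operator algebra is of CFT type: `Vₙ = 0` for `n < 0`, and `V₀` is the line spanned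
by the vacuum vector. -/
structure IsCFTType (c : ℂ) (ν : V) : Prop extends A.IsVertexOperatorAlgebra c ν where
  homogeneous_neg : ∀ n < 0, A.homogeneous ν n = ⊥
  homogeneous_zero : A.homogeneous ν 0 = Submodule.span ℂ {A.vac}
  vac_ne_zero : A.vac ≠ 0

/-- A set `S` of fields of the vertex algebra strongly generates it: the vectors
`a¹₍ⱼ₁₎ ⋯ aᵏ₍ⱼₖ₎ |0⟩` with `k ≥ 0`, `aⁱ(z) ∈ S` and all `jᵢ < 0` span `V`. -/
def IsStronglyGeneratedBy (S : Set (VertexOperator ℂ V)) : Prop :=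
  S ⊆ Set.range A.Y ∧
    Submodule.span ℂ {v | ∃ l : List (VertexOperator ℂ V × ℤ), (∀ p ∈ l, p.1 ∈ S ∧ p.2 < 0) ∧
      v = (l.map fun p => p.1.ncoeff p.2).prod A.vac} = ⊤

end VertexAlgebra

end

/-! The vertex algebra comes from the reconstruction theorem `VertexAlgebra.exists_of_generating`.
Inside the space `localFields` of translation covariant, creative fields local to the generators,
the map F ↦ F₍₋₁₎|0⟩ is injective by Goddard's argument (`fieldState_injective`): a field creating 0
kills |0⟩, hence by locality every vector generated from it. It is surjective because, by Dong's
lemma (`MutuallyLocal.normalProd`), `localFields` is closed under normally ordered products with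
derivatives of generators, and these create the spanning vectors. The inverse map is Y.

For V the only generator is L(z). The Virasoro relations give its locality, its OPE and its
covariance under L₋₁, and L₋₁v₀ = 0 makes it creative. Monomials in the Lₙ with n ≤ -2 span V and
are L₀-eigenvectors, finitely many in each weight; this gives the grading without any linear
independence of PBW type.

The one fact that needs a model is v₀ ≠ 0. The Fock space ℂ[x₁, x₂, …] carries Sugawara operators
with a background charge l, of central charge 1 - 12 l². Since ℂ is algebraically closed every c
occurs, and the polynomial 1 satisfies all relations imposed on v₀. -/

noncomputable section

namespace FormalDistribution

/-! ### Multiplication by `z - w` -/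

section Sub

variable {M M' : Type*} [AddCommGroup M] [AddCommGroup M']

theorem endMul_apply (f g : AddMonoid.End M) (x : M) : (f * g) x = f (g x) := rfl

theorem endSub_apply (f g : AddMonoid.End M) (x : M) : (f - g) x = f x - g x := rfl

/-- Multiplication of a two-variable formal distribution by `z - w`, as an additive map. -/
def subHom : AddMonoid.End (ℤ → ℤ → M) where
  toFun f m n := f (m + 1) n - f m (n + 1)
  map_zero' := by ext; simp
  map_add' f g := by ext; simp; abel

theorem subHom_apply (f : ℤ → ℤ → M) (m n : ℤ) :
    subHom f m n = f (m + 1) n - f m (n + 1) := rfl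

theorem mulSub_iterate {E : Type*} [Ring E] (N : ℕ) (f : ℤ → ℤ → E) :
    mulSub^[N] f = (subHom ^ N) f := by
  induction N generalizing f with
  | zero => rfl
  | succ N ih => rw [Function.iterate_succ_apply, ih, pow_succ]; rfl

theorem subHom_pow_succ (N : ℕ) (f : ℤ → ℤ → M) :
    (subHom ^ (N + 1)) f = (subHom ^ N) (subHom f) := by rw [pow_succ]; rfl

/-- Used both to multiply locality relations by a fixed operator and to evaluate them at a vector.
-/
theorem subHom_pow_map (φ : M →+ M') (N : ℕ) (f : ℤ → ℤ → M) :
    (subHom ^ N) (fun m n => φ (f m n)) = fun m n => φ ((subHom ^ N) f m n) := by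
  induction N generalizing f with
  | zero => rfl
  | succ N ih =>
    rw [subHom_pow_succ, subHom_pow_succ, ← ih]
    congr 1
    ext m n
    simp [subHom_apply]

theorem subHom_pow_eq_zero_of_le {N K : ℕ} (h : N ≤ K) {f : ℤ → ℤ → M}
    (hf : (subHom ^ N) f = 0) : (subHom ^ K) f = 0 := by
  obtain ⟨d, rfl⟩ := Nat.exists_eq_add_of_le' h
  rw [pow_add, endMul_apply, hf, map_zero]

theorem subHom_pow_swap (N : ℕ) (f : ℤ → ℤ → M) (m n : ℤ) :
    (subHom ^ N) (fun m n => f n m) m n = (-1 : ℤ) ^ N • (subHom ^ N) f n m := by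
  induction N generalizing f with
  | zero => simp
  | succ N ih =>
    have : subHom (fun m n => f n m) = fun m n => (-subHom f) n m := by
      ext m n; simp [subHom_apply]
    rw [subHom_pow_succ, subHom_pow_succ, this, ih, map_neg, pow_succ]
    simp

/-- Induction on N through (z - w)∂f = ∂((z - w)f) - f, with ∂ taken in z. -/
theorem subHom_pow_deriv {N : ℕ} {f : ℤ → ℤ → M} (hf : (subHom ^ N) f = 0) :
    (subHom ^ (N + 1)) (fun m n => (-m) • f (m - 1) n) = 0 := by
  induction N generalizing f with
  | zero =>
    obtain rfl : f = 0 := hf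
    simp only [Pi.zero_apply, smul_zero]
    exact map_zero (subHom (M := M) ^ 1)
  | succ N ih =>
    rw [subHom_pow_succ]
    have : subHom (fun m n => (-m) • f (m - 1) n)
        = (fun m n => (-m) • subHom f (m - 1) n) - f := by
      ext m n
      simp only [subHom_apply, Pi.sub_apply, add_sub_cancel_right, sub_add_cancel]
      module
    rw [this, map_sub, hf, sub_zero]
    exact ih (by rw [← subHom_pow_succ]; exact hf)

/-- A distribution that is annihilated by a power of `z - w` and is a Laurent series in `w`
vanishes. -/
theorem eq_zero_of_subHom_pow_eq_zero {N : ℕ} {f : ℤ → ℤ → M} (hf : (subHom ^ N) f = 0)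
    {K : ℤ} (hK : ∀ m n, K ≤ n → f m n = 0) : f = 0 := by
  induction N generalizing f with
  | zero => exact hf
  | succ N ih =>
    have h : subHom f = 0 := by
      refine ih (by rw [← subHom_pow_succ]; exact hf) fun m n hn => ?_
      rw [subHom_apply, hK _ _ hn, hK _ _ (by omega), sub_zero]
    -- (z - w)f = 0 makes coefficients constant along m + n = const, so each one can be slid to
    -- where n ≥ K.
    have hs (k : ℕ) (m n : ℤ) : f m n = f (m - k) (n + k) := by
      induction k generalizing m n with
      | zero => simp
      | succ k ihk =>
        have := congrFun (congrFun h (m - 1)) n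
        rw [subHom_apply, sub_add_cancel, Pi.zero_apply, Pi.zero_apply, sub_eq_zero] at this
        rw [this, ihk]
        push_cast
        congr 1 <;> ring
    ext m n
    rw [hs (K - n).toNat, hK _ _ (by omega)]
    rfl

end Sub

theorem mutuallyLocal_iff {E : Type*} [Ring E] {a b : ℤ → E} :
    MutuallyLocal a b ↔ ∃ N : ℕ, (subHom ^ N) (commutator a b) = 0 := by
  simp [MutuallyLocal, mulSub_iterate]

theorem MutuallyLocal.symm {E : Type*} [Ring E] {a b : ℤ → E} (h : MutuallyLocal a b) :
    MutuallyLocal b a := by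
  obtain ⟨N, hN⟩ := mutuallyLocal_iff.1 h
  refine mutuallyLocal_iff.2 ⟨N, ?_⟩
  have : commutator b a = fun m n => (-commutator a b) n m := by
    ext m n; simp [commutator]
  ext m n
  rw [this, subHom_pow_swap, map_neg, hN]
  simp

theorem MutuallyLocal.deriv {E : Type*} [Ring E] {a b : ℤ → E} (h : MutuallyLocal a b) :
    MutuallyLocal (deriv a) b := by
  obtain ⟨N, hN⟩ := mutuallyLocal_iff.1 h
  refine mutuallyLocal_iff.2 ⟨N + 1, ?_⟩
  convert subHom_pow_deriv hN using 2
  ext m n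
  simp only [commutator, FormalDistribution.deriv, smul_mul_assoc, mul_smul_comm, smul_sub]

theorem mutuallyLocal_const_one {E : Type*} [Ring E] (b : ℤ → E) :
    MutuallyLocal (const 1) b := by
  refine mutuallyLocal_iff.2 ⟨0, ?_⟩
  ext m n
  simp [commutator, const]

/-! ### Three-variable distributions -/

section Three

variable {M : Type*} [AddCommGroup M]

/-- Multiplication of a distribution in `z, w, x` by `z - w`. -/
def subZW : AddMonoid.End (ℤ → ℤ → ℤ → M) where
  toFun f p q k := f (p + 1) q k - f p (q + 1) k
  map_zero' := by ext; simp
  map_add' f g := by ext; simp; abel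

/-- Multiplication of a distribution in `z, w, x` by `z - x`. -/
def subZX : AddMonoid.End (ℤ → ℤ → ℤ → M) where
  toFun f p q k := f (p + 1) q k - f p q (k + 1)
  map_zero' := by ext; simp
  map_add' f g := by ext; simp; abel

/-- Multiplication of a distribution in `z, w, x` by `w - x`. -/
def subWX : AddMonoid.End (ℤ → ℤ → ℤ → M) where
  toFun f p q k := f p (q + 1) k - f p q (k + 1)
  map_zero' := by ext; simp
  map_add' f g := by ext; simp; abel

theorem subZW_apply (f : ℤ → ℤ → ℤ → M) (p q k : ℤ) :
    subZW f p q k = f (p + 1) q k - f p (q + 1) k := rfl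

theorem subZX_apply (f : ℤ → ℤ → ℤ → M) (p q k : ℤ) :
    subZX f p q k = f (p + 1) q k - f p q (k + 1) := rfl

theorem subWX_apply (f : ℤ → ℤ → ℤ → M) (p q k : ℤ) :
    subWX f p q k = f p (q + 1) k - f p q (k + 1) := rfl

theorem subWX_eq : (subWX : AddMonoid.End (ℤ → ℤ → ℤ → M)) = subZX - subZW := by
  ext f p q k
  rw [endSub_apply]
  simp [subWX_apply, subZX_apply, subZW_apply]

theorem commute_subZX_subZW : Commute (subZX : AddMonoid.End (ℤ → ℤ → ℤ → M)) subZW := by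
  ext f p q k
  simp only [endMul_apply, subZX_apply, subZW_apply]
  abel

theorem commute_subZX_subWX : Commute (subZX : AddMonoid.End (ℤ → ℤ → ℤ → M)) subWX := by
  rw [subWX_eq]
  exact (Commute.refl _).sub_right commute_subZX_subZW

theorem commute_subZW_subWX : Commute (subZW : AddMonoid.End (ℤ → ℤ → ℤ → M)) subWX := by
  rw [subWX_eq]
  exact commute_subZX_subZW.symm.sub_right (Commute.refl _)

theorem subZW_pow_apply (N : ℕ) (f : ℤ → ℤ → ℤ → M) (p q k : ℤ) :
    (subZW ^ N) f p q k = (subHom ^ N) (fun p q => f p q k) p q := by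
  induction N generalizing f with
  | zero => rfl
  | succ N ih => rw [subHom_pow_succ, pow_succ, endMul_apply, ih]; rfl

theorem subZX_pow_apply (N : ℕ) (f : ℤ → ℤ → ℤ → M) (p q k : ℤ) :
    (subZX ^ N) f p q k = (subHom ^ N) (fun p k => f p q k) p k := by
  induction N generalizing f with
  | zero => rfl
  | succ N ih => rw [subHom_pow_succ, pow_succ, endMul_apply, ih]; rfl

theorem subWX_pow_apply (N : ℕ) (f : ℤ → ℤ → ℤ → M) (p q k : ℤ) :
    (subWX ^ N) f p q k = (subHom ^ N) (f p) q k := by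
  induction N generalizing f with
  | zero => rfl
  | succ N ih => rw [subHom_pow_succ, pow_succ, endMul_apply, ih]; rfl

/-- If commuting operators `A`, `B` act nilpotently on `x`, then so does `A - B`. -/
theorem sub_pow_apply_eq_zero {A B : AddMonoid.End M} (h : Commute A B) {i j : ℕ} {x : M}
    (hA : (A ^ i) x = 0) (hB : (B ^ j) x = 0) : ((A - B) ^ (i + j)) x = 0 := by
  induction hn : i + j generalizing i j x with
  | zero =>
    obtain rfl : i = 0 := by omega
    exact hA
  | succ n ih =>
    have hA' : ((A - B) ^ n) (A x) = 0 := by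
      rcases i with _ | i
      · obtain rfl : x = 0 := hA
        simp
      · refine ih (i := i) (j := j) (by rw [pow_succ] at hA; exact hA) ?_ (by omega)
        rw [← endMul_apply, ← (h.pow_right j).eq, endMul_apply, hB, map_zero]
    have hB' : ((A - B) ^ n) (B x) = 0 := by
      rcases j with _ | j
      · obtain rfl : x = 0 := hB
        simp
      · refine ih (i := i) (j := j) ?_ (by rw [pow_succ] at hB; exact hB) (by omega)
        rw [← endMul_apply, (h.pow_left i).eq, endMul_apply, hA, map_zero]
    rw [pow_succ, endMul_apply, endSub_apply, map_sub, hA', hB', sub_zero]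

/-- A distribution in `z, w, x` can be restricted to `z = w`. -/
def DiagSummable (f : ℤ → ℤ → ℤ → M) : Prop :=
  ∀ s k, (Function.support fun p => f p (s - p) k).Finite

/-- Restriction of a distribution in `z, w, x` to `z = w`. -/
def diag (f : ℤ → ℤ → ℤ → M) : ℤ → ℤ → M := fun m k => ∑ᶠ p, f p (m - 1 - p) k

theorem DiagSummable.subZX {f : ℤ → ℤ → ℤ → M} (hf : DiagSummable f) :
    DiagSummable (subZX f) := by
  intro s k
  have h1 := (hf (s + 1) k).preimage (add_left_injective (1 : ℤ)).injOn
  refine (h1.union (hf s (k + 1))).subset fun p hp => ?_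
  contrapose! hp
  simp only [Set.mem_union, Set.mem_preimage, Function.mem_support, not_or, not_not,
    subZX_apply] at hp ⊢
  rw [show s + 1 - (p + 1) = s - p by ring] at hp
  rw [hp.1, hp.2, sub_zero]

theorem DiagSummable.subWX {f : ℤ → ℤ → ℤ → M} (hf : DiagSummable f) :
    DiagSummable (subWX f) := by
  intro s k
  refine ((hf (s + 1) k).union (hf s (k + 1))).subset fun p hp => ?_
  contrapose! hp
  simp only [Set.mem_union, Function.mem_support, not_or, not_not, subWX_apply] at hp ⊢
  rw [show s + 1 - p = s - p + 1 by ring] at hp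
  rw [hp.1, hp.2, sub_zero]

/-- On z = w both w - x and z - x become the same factor. This is how a product of powers of the two
turns into a single locality power. -/
theorem diag_subWX {f : ℤ → ℤ → ℤ → M} (hf : DiagSummable f) :
    diag (subWX f) = subHom (diag f) := by
  ext m k
  simp only [diag, subHom_apply]
  rw [← finsum_sub_distrib (hf _ _) (hf _ _)]
  refine finsum_congr fun p => ?_
  rw [subWX_apply]
  congr 2
  ring

theorem diag_subZX {f : ℤ → ℤ → ℤ → M} (hf : DiagSummable f) :
    diag (subZX f) = subHom (diag f) := by
  ext m k
  simp only [diag, subHom_apply]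
  rw [← finsum_comp_equiv (Equiv.addRight (1 : ℤ))
    (f := fun p => f p (m + 1 - 1 - p) k)]
  rw [← finsum_sub_distrib]
  · refine finsum_congr fun p => ?_
    rw [subZX_apply, Equiv.coe_addRight]
    congr 2
    ring
  · exact (hf (m + 1 - 1) k).preimage (add_left_injective (1 : ℤ)).injOn
  · exact hf _ _

theorem DiagSummable.subWX_pow {f : ℤ → ℤ → ℤ → M} (hf : DiagSummable f) (N : ℕ) :
    DiagSummable ((FormalDistribution.subWX ^ N) f) := by
  induction N with
  | zero => exact hf
  | succ N ih => rw [pow_succ']; exact ih.subWX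

theorem DiagSummable.subZX_pow {f : ℤ → ℤ → ℤ → M} (hf : DiagSummable f) (N : ℕ) :
    DiagSummable ((FormalDistribution.subZX ^ N) f) := by
  induction N with
  | zero => exact hf
  | succ N ih => rw [pow_succ']; exact ih.subZX

theorem diag_subWX_pow {f : ℤ → ℤ → ℤ → M} (hf : DiagSummable f) (N : ℕ) :
    diag ((subWX ^ N) f) = (subHom ^ N) (diag f) := by
  induction N with
  | zero => rfl
  | succ N ih =>
    rw [pow_succ', pow_succ', endMul_apply, endMul_apply,
      diag_subWX (hf.subWX_pow N), ih]

theorem diag_subZX_pow {f : ℤ → ℤ → ℤ → M} (hf : DiagSummable f) (N : ℕ) :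
    diag ((subZX ^ N) f) = (subHom ^ N) (diag f) := by
  induction N with
  | zero => rfl
  | succ N ih =>
    rw [pow_succ', pow_succ', endMul_apply, endMul_apply,
      diag_subZX (hf.subZX_pow N), ih]

end Three

/-- The commutator `[:a(z)b(w):, c(x)]` is annihilated by `(z - x)ᴺ (w - x)³ᴺ` if `a`, `b`, `c` are
pairwise local of order `N`. -/
theorem subZX_subWX_commutator_normalOrder {E : Type*} [Ring E] {a b c : ℤ → E} {N : ℕ}
    (hab : (subHom ^ N) (commutator a b) = 0) (hac : (subHom ^ N) (commutator a c) = 0)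
    (hbc : (subHom ^ N) (commutator b c) = 0) :
    (subZX ^ N) ((subWX ^ (N + N + N))
      fun p q k => normalOrder a b p q * c k - c k * normalOrder a b p q) = 0 := by
  -- F₁ and F₂ are the commutators for the two orders of a and b; normal ordering picks one by the
  -- sign of p.
  set F₁ : ℤ → ℤ → ℤ → E := fun p q k => a p * b q * c k - c k * (a p * b q) with hF₁
  set F₂ : ℤ → ℤ → ℤ → E := fun p q k => b q * a p * c k - c k * (b q * a p) with hF₂
  have hl (e : E) (f : ℤ → ℤ → E) (hf : (subHom ^ N) f = 0) :
      (subHom ^ N) (fun m n => e * f m n) = 0 := by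
    have := subHom_pow_map (AddMonoidHom.mulLeft e) N f
    rw [hf] at this
    ext m n
    simpa using congrFun (congrFun this m) n
  have hr (e : E) (f : ℤ → ℤ → E) (hf : (subHom ^ N) f = 0) :
      (subHom ^ N) (fun m n => f m n * e) = 0 := by
    have := subHom_pow_map (AddMonoidHom.mulRight e) N f
    rw [hf] at this
    ext m n
    simpa using congrFun (congrFun this m) n
  have hcomm : Commute ((subZX : AddMonoid.End (ℤ → ℤ → ℤ → E)) ^ N) (subWX ^ N) :=
    (commute_subZX_subWX.pow_left N).pow_right N
  have split (g h : ℤ → ℤ → ℤ → E) (hg : (subWX ^ N) g = 0) (hh : (subZX ^ N) h = 0) :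
      (subZX ^ N) ((subWX ^ N) (g + h)) = 0 := by
    rw [map_add, hg, zero_add, ← endMul_apply, hcomm.eq, endMul_apply, hh,
      map_zero]
  have h₁ : (subZX ^ N) ((subWX ^ N) F₁) = 0 := by
    have : F₁ = (fun p q k => a p * commutator b c q k)
        + fun p q k => commutator a c p k * b q := by
      ext p q k
      simp only [hF₁, commutator, Pi.add_apply]
      noncomm_ring
    rw [this]
    refine split _ _ ?_ ?_
    · ext p q k
      rw [subWX_pow_apply, hl _ _ hbc]; rfl
    · ext p q k
      rw [subZX_pow_apply, hr _ _ hac]; rfl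
  have h₂ : (subZX ^ N) ((subWX ^ N) F₂) = 0 := by
    have : F₂ = (fun p q k => commutator b c q k * a p)
        + fun p q k => b q * commutator a c p k := by
      ext p q k
      simp only [hF₂, commutator, Pi.add_apply]
      noncomm_ring
    rw [this]
    refine split _ _ ?_ ?_
    · ext p q k
      rw [subWX_pow_apply, hr _ _ hbc]; rfl
    · ext p q k
      rw [subZX_pow_apply, hl _ _ hac]; rfl
  have hD : (subZW ^ N) (F₁ - F₂) = 0 := by
    have : F₁ - F₂ = (fun p q k => commutator a b p q * c k)
        - fun p q k => c k * commutator a b p q := by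
      ext p q k
      simp only [hF₁, hF₂, commutator, Pi.sub_apply]
      noncomm_ring
    ext p q k
    rw [this, map_sub, Pi.sub_apply, Pi.sub_apply, Pi.sub_apply, subZW_pow_apply, subZW_pow_apply,
      hr _ _ hab, hl _ _ hab]
    simp
  -- After N factors w - x, the difference F₁ - F₂ is killed by (z - x)ᴺ and by (z - w)ᴺ. As w - x =
  -- (z - x) - (z - w), another 2N factors w - x kill it.
  have hD' : (subWX ^ (N + N + N)) F₁ = (subWX ^ (N + N + N)) F₂ := by
    rw [← sub_eq_zero, ← map_sub, pow_add, endMul_apply, subWX_eq]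
    refine sub_pow_apply_eq_zero commute_subZX_subZW ?_ ?_
    · rw [← subWX_eq, map_sub, map_sub, h₁, h₂, sub_zero]
    · rw [← subWX_eq, ← endMul_apply,
        ((commute_subZW_subWX.pow_left N).pow_right N).eq, endMul_apply, hD, map_zero]
  -- Multiplication by w - x leaves p fixed, so it respects the case split on the sign of p, and
  -- both cases now agree with F₁.
  have hG : (subWX ^ (N + N + N))
      (fun p q k => normalOrder a b p q * c k - c k * normalOrder a b p q)
      = (subWX ^ (N + N + N)) F₁ := by
    ext p q k
    by_cases hp : p < 0
    · simp only [subWX_pow_apply, hF₁, normalOrder, hp, if_true]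
    · rw [hD']
      simp only [subWX_pow_apply, hF₂, normalOrder, hp, if_false]
  rw [hG, pow_add, endMul_apply, ← endMul_apply,
    ((commute_subZX_subWX.pow_left N).pow_right (N + N)).eq, endMul_apply, h₁, map_zero]

/-! ### Fields and their normally ordered products -/

section Fields

variable {R V : Type*} [CommRing R] [AddCommGroup V] [Module R V]

/-- The modes `a₍ₙ₎` form a field: `a₍ₙ₎ v = 0` for `n ≫ 0`. -/
def IsField (a : ℤ → Module.End R V) : Prop := ∀ v, ∃ K : ℤ, ∀ n, K ≤ n → a n v = 0

theorem IsField.deriv {a : ℤ → Module.End R V} (ha : IsField a) : IsField (deriv a) := by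
  intro v
  obtain ⟨K, hK⟩ := ha v
  exact ⟨K + 1, fun n hn => by
    simp [FormalDistribution.deriv, hK (n - 1) (by omega)]⟩

theorem isField_const (e : Module.End R V) : IsField (const e) :=
  fun v => ⟨0, fun n hn => by rw [const, if_neg (by omega)]; rfl⟩

/-- Normal ordering puts on the right the factor whose mode grows: a₍ₚ₎ as p → ∞, and b₍ₛ₋ₚ₎ as p →
-∞. -/
theorem normalOrder_support_finite {a b : ℤ → Module.End R V} (ha : IsField a) (hb : IsField b)
    (s : ℤ) (v : V) : (Function.support fun p => normalOrder a b p (s - p) v).Finite := by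
  obtain ⟨K, hK⟩ := ha v
  obtain ⟨K', hK'⟩ := hb v
  refine (Set.finite_Icc (min 0 (s - K')) (max 0 K)).subset fun p hp => ?_
  contrapose! hp
  rw [Set.mem_Icc, not_and_or, not_le, not_le] at hp
  rw [Function.notMem_support, normalOrder]
  rcases hp with hp | hp
  · rw [if_pos (by omega), Module.End.mul_apply, hK' _ (by omega), map_zero]
  · rw [if_neg (by omega), Module.End.mul_apply, hK _ (by omega), map_zero]

/-- The modes of the normally ordered product `:a(z)b(z):`. -/
def normalProd {a b : ℤ → Module.End R V} (ha : IsField a) (hb : IsField b) (m : ℤ) :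
    Module.End R V where
  toFun v := ∑ᶠ p, normalOrder a b p (m - 1 - p) v
  map_add' v w := by
    simp only [map_add]
    exact finsum_add_distrib (normalOrder_support_finite ha hb _ _)
      (normalOrder_support_finite ha hb _ _)
  map_smul' r v := by
    simp only [map_smul, RingHom.id_apply]
    exact (smul_finsum' r (normalOrder_support_finite ha hb _ _)).symm

variable {a b c : ℤ → Module.End R V} (ha : IsField a) (hb : IsField b)

theorem normalProd_apply (m : ℤ) (v : V) :
    normalProd ha hb m v = ∑ᶠ p, normalOrder a b p (m - 1 - p) v := rfl

theorem isField_normalProd : IsField (normalProd ha hb) := by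
  intro v
  obtain ⟨K', hK'⟩ := hb v
  obtain ⟨K, hK⟩ := ha v
  -- Only the finitely many p in [0, K] need a bound depending on p; the part p < 0 is handled by b
  -- alone.
  have h (p : ℤ) : ∃ B : ℤ, ∀ n, B ≤ n → b (n - 1 - p) (a p v) = 0 := by
    obtain ⟨B, hB⟩ := hb (a p v)
    exact ⟨B + 1 + p, fun n hn => hB _ (by omega)⟩
  choose B hB using h
  obtain ⟨C, hC⟩ := ((Set.finite_Icc (0 : ℤ) K).image B).bddAbove
  refine ⟨max C K', fun n hn => ?_⟩
  rw [normalProd_apply]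
  refine finsum_eq_zero_of_forall_eq_zero fun p => ?_
  rw [normalOrder]
  split_ifs with hp
  · rw [Module.End.mul_apply, hK' _ (by omega), map_zero]
  · rw [Module.End.mul_apply]
    by_cases hpK : p ≤ K
    · exact hB p n ((hC ⟨p, ⟨by omega, hpK⟩, rfl⟩).trans (by omega))
    · rw [hK _ (by omega), map_zero]

/-- Dong's lemma for the normally ordered product. -/
theorem MutuallyLocal.normalProd (hab : MutuallyLocal a b) (hac : MutuallyLocal a c)
    (hbc : MutuallyLocal b c) : MutuallyLocal (normalProd ha hb) c := by
  obtain ⟨N₁, h₁⟩ := mutuallyLocal_iff.1 hab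
  obtain ⟨N₂, h₂⟩ := mutuallyLocal_iff.1 hac
  obtain ⟨N₃, h₃⟩ := mutuallyLocal_iff.1 hbc
  set N := max N₁ (max N₂ N₃) with hN
  have key := subZX_subWX_commutator_normalOrder
    (subHom_pow_eq_zero_of_le (K := N) (by omega) h₁)
    (subHom_pow_eq_zero_of_le (K := N) (by omega) h₂)
    (subHom_pow_eq_zero_of_le (K := N) (by omega) h₃)
  refine mutuallyLocal_iff.2 ⟨N + (N + N + N), ?_⟩
  ext m k v
  -- The sum over the diagonal is finite only after evaluation at a vector.
  set ev : Module.End R V →+ V := (LinearMap.applyₗ v).toAddMonoidHom with hev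
  set G : ℤ → ℤ → ℤ → V := fun p q k =>
    ev (normalOrder a b p q * c k - c k * normalOrder a b p q) with hG
  have hsum : DiagSummable G := by
    intro s k
    refine ((normalOrder_support_finite ha hb s (c k v)).union
      (normalOrder_support_finite ha hb s v)).subset fun p hp => ?_
    contrapose! hp
    simp only [Set.mem_union, Function.mem_support, not_or, not_not] at hp ⊢
    simp [hG, hev, hp.1, hp.2]
  have hdiag : (fun m k => ev (commutator (FormalDistribution.normalProd ha hb) c m k))
      = diag G := by
    ext m k
    simp only [hev, hG, commutator, diag, LinearMap.toAddMonoidHom_coe,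
      LinearMap.applyₗ_apply_apply, LinearMap.sub_apply, Module.End.mul_apply, normalProd_apply]
    rw [finsum_sub_distrib (normalOrder_support_finite ha hb _ _), map_finsum]
    · exact normalOrder_support_finite ha hb _ _
    · refine (normalOrder_support_finite ha hb (m - 1) v).subset fun p hp => ?_
      contrapose! hp
      rw [Function.notMem_support] at hp ⊢
      rw [hp, map_zero]
  have h := congrFun (congrFun (subHom_pow_map ev (N + (N + N + N))
    (commutator (FormalDistribution.normalProd ha hb) c)) m) k
  have hz : (subZX ^ N) ((subWX ^ (N + N + N)) G) = 0 := by
    have hm1 : (subWX ^ (N + N + N)) G = fun p q k => ev ((subWX ^ (N + N + N))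
        (fun p q k => normalOrder a b p q * c k - c k * normalOrder a b p q) p q k) := by
      ext p q k
      rw [subWX_pow_apply, subWX_pow_apply]
      exact congrFun (congrFun (subHom_pow_map ev _ _) q) k
    ext p q k
    rw [hm1, subZX_pow_apply]
    refine (congrFun (congrFun (subHom_pow_map ev _ _) p) k).trans ?_
    rw [← subZX_pow_apply N _ p q k, key]
    simp
  rw [hdiag, pow_add, endMul_apply, ← diag_subWX_pow hsum,
    ← diag_subZX_pow (hsum.subWX_pow _), hz] at h
  simpa [diag, hev] using h.symm

/-- `[T, a(z)] = ∂a(z)`. -/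
def IsTranslationCovariant (T : Module.End R V) (a : ℤ → Module.End R V) : Prop :=
  ∀ n, T * a n - a n * T = FormalDistribution.deriv a n

theorem IsTranslationCovariant.deriv {T : Module.End R V} (h : IsTranslationCovariant T a) :
    IsTranslationCovariant T (FormalDistribution.deriv a) := by
  intro n
  have := h (n - 1)
  simp only [FormalDistribution.deriv] at this ⊢
  rw [mul_smul_comm, smul_mul_assoc, ← smul_sub, this]

theorem IsTranslationCovariant.const_one (T : Module.End R V) :
    IsTranslationCovariant T (const 1) := by
  intro n
  simp only [const, FormalDistribution.deriv, mul_ite, ite_mul, mul_one, one_mul, mul_zero,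
    zero_mul, sub_self]
  split_ifs with h
  · obtain rfl : n = 0 := by omega
    simp
  · simp

theorem IsTranslationCovariant.normalProd {T : Module.End R V} (hTa : IsTranslationCovariant T a)
    (hTb : IsTranslationCovariant T b) : IsTranslationCovariant T (normalProd ha hb) := by
  have hN (p q : ℤ) (v : V) : T (normalOrder a b p q v) - normalOrder a b p q (T v)
      = (-p) • normalOrder a b (p - 1) q v + (-q) • normalOrder a b p (q - 1) v := by
    have h1 (w : V) : T (a p w) = a p (T w) + (-p) • a (p - 1) w := by
      have := LinearMap.congr_fun (hTa p) w
      simp only [FormalDistribution.deriv, LinearMap.sub_apply, Module.End.mul_apply,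
        LinearMap.smul_apply] at this
      rw [← this]; abel
    have h2 (w : V) : T (b q w) = b q (T w) + (-q) • b (q - 1) w := by
      have := LinearMap.congr_fun (hTb q) w
      simp only [FormalDistribution.deriv, LinearMap.sub_apply, Module.End.mul_apply,
        LinearMap.smul_apply] at this
      rw [← this]; abel
    rcases lt_trichotomy p 0 with hp | rfl | hp
    · simp only [normalOrder, hp, show p - 1 < 0 by omega, if_true, Module.End.mul_apply, h1, h2,
        map_add, map_zsmul]
      abel
    -- At p = 0 the derivative would move a across the ordering threshold, but its coefficient -p is
    -- zero.
    · simp only [normalOrder, lt_irrefl, if_false, Module.End.mul_apply, h1, h2,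
        map_add, neg_zero, zero_smul, map_zero]
      abel
    · simp only [normalOrder, show ¬ p < 0 by omega, show ¬ p - 1 < 0 by omega, if_false,
        Module.End.mul_apply, h1, h2, map_add, map_zsmul]
      abel
  intro m
  ext v
  have hfin := normalOrder_support_finite ha hb (m - 2) v
  have hT : (Function.support fun p => T (normalOrder a b p (m - 1 - p) v)).Finite := by
    refine (normalOrder_support_finite ha hb (m - 1) v).subset fun p hp => ?_
    contrapose! hp
    rw [Function.notMem_support] at hp ⊢
    rw [hp, map_zero]
  have hsm (g : ℤ → ℤ) : (Function.support fun p =>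
      g p • normalOrder a b p (m - 2 - p) v).Finite := by
    refine hfin.subset fun p hp => ?_
    contrapose! hp
    rw [Function.notMem_support] at hp ⊢
    rw [hp, smul_zero]
  simp only [LinearMap.sub_apply, Module.End.mul_apply, FormalDistribution.deriv,
    LinearMap.smul_apply, normalProd_apply]
  rw [map_finsum _ (normalOrder_support_finite ha hb _ _),
    ← finsum_sub_distrib hT (normalOrder_support_finite ha hb _ _)]
  simp only [hN]
  -- After the shift of p the coefficients add up to -(p + 1) - (m - 1 - p) = -m, as for ∂.
  have e1 (p : ℤ) : (-p) • normalOrder a b (p - 1) (m - 1 - p) v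
      = (fun p => (-(p + 1)) • normalOrder a b p (m - 2 - p) v) (p - 1) := by
    simp only [sub_add_cancel]
    congr 3; ring
  have e2 (p : ℤ) : (-(m - 1 - p)) • normalOrder a b p (m - 1 - p - 1) v
      = (fun p => (-(m - 1 - p)) • normalOrder a b p (m - 2 - p) v) p := by
    simp only
    congr 3; ring
  rw [finsum_add_distrib]
  · rw [finsum_congr e1, finsum_congr e2, show (∑ᶠ p : ℤ,
        (fun p => (-(p + 1)) • normalOrder a b p (m - 2 - p) v) (p - 1)) = _ from
        finsum_comp_equiv (Equiv.subRight (1 : ℤ))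
          (f := fun p => (-(p + 1)) • normalOrder a b p (m - 2 - p) v),
      ← finsum_add_distrib (hsm _) (hsm _), smul_finsum']
    · refine finsum_congr fun p => ?_
      rw [← add_smul]
      congr 1
      · ring
      · congr 2; ring
    · exact normalOrder_support_finite ha hb (m - 1 - 1) v
  · simp only [e1]
    exact (hsm fun p => -(p + 1)).preimage (sub_left_injective (b := (1 : ℤ))).injOn
  · simp only [e2]
    exact hsm fun p => -(m - 1 - p)

/-- `a(z)|0⟩` has no negative powers of `z`. -/
def IsCreative (vac : V) (a : ℤ → Module.End R V) : Prop := ∀ n, 0 ≤ n → a n vac = 0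

theorem IsCreative.deriv {vac : V} (h : IsCreative vac a) :
    IsCreative vac (FormalDistribution.deriv a) := by
  intro n hn
  rcases hn.eq_or_lt with rfl | hn
  · simp [FormalDistribution.deriv]
  · simp [FormalDistribution.deriv, h (n - 1) (by omega)]

theorem isCreative_const (vac : V) (e : Module.End R V) : IsCreative vac (const e) :=
  fun n hn => by rw [const, if_neg (by omega)]; rfl

theorem IsCreative.normalProd {vac : V} (h₁ : IsCreative vac a) (h₂ : IsCreative vac b) :
    IsCreative vac (normalProd ha hb) := by
  intro n hn
  refine finsum_eq_zero_of_forall_eq_zero fun p => ?_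
  rw [normalOrder]
  split_ifs with hp
  · rw [Module.End.mul_apply, h₂ _ (by omega), map_zero]
  · rw [Module.End.mul_apply, h₁ _ (by omega), map_zero]

/-- For p < -1 the mode -2 - p of b is nonnegative, so only p = -1 survives. This lets normally
ordered products build up states one mode at a time. -/
theorem normalProd_neg_one_vac {vac : V} (h₁ : IsCreative vac a) (h₂ : IsCreative vac b) :
    normalProd ha hb (-1) vac = a (-1) (b (-1) vac) := by
  rw [normalProd_apply, finsum_eq_single _ (-1 : ℤ)]
  · simp [normalOrder]
  · intro p hp
    rw [normalOrder]
    split_ifs with hp'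
    · rw [Module.End.mul_apply, h₂ _ (by omega), map_zero]
    · rw [Module.End.mul_apply, h₁ _ (by omega), map_zero]

/-- A translation covariant, creative field with `a₍₋₁₎|0⟩ = 0` annihilates the vacuum. -/
theorem apply_vac_eq_zero [IsAddTorsionFree V] {T : Module.End R V} {vac : V} (hT : T vac = 0)
    (h₁ : IsTranslationCovariant T a) (h₂ : IsCreative vac a) (h : a (-1) vac = 0) (n : ℤ) :
    a n vac = 0 := by
  rcases le_or_gt 0 n with hn | hn
  · exact h₂ n hn
  obtain ⟨k, rfl⟩ : ∃ k : ℕ, n = -1 - k := ⟨(-1 - n).toNat, by omega⟩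
  clear hn
  induction k with
  | zero => simpa using h
  | succ k ih =>
    -- As T|0⟩ = 0, covariance gives T a₍ₙ₎|0⟩ = -n a₍ₙ₋₁₎|0⟩ with -n ≠ 0, a recursion down from n =
    -- -1.
    have := LinearMap.congr_fun (h₁ (-1 - k)) vac
    simp only [LinearMap.sub_apply, Module.End.mul_apply, hT, ih, map_zero, sub_zero,
      FormalDistribution.deriv, LinearMap.smul_apply] at this
    have := (smul_eq_zero.1 this.symm).resolve_left (by omega)
    convert this using 2
    push_cast
    congr 1; ring

/-- If `a` is local with respect to `b` and `a(z)v = 0`, then `a(z)b(w)v = 0`. -/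
theorem MutuallyLocal.apply_eq_zero (hab : MutuallyLocal a b) (hb : IsField b) {v : V}
    (h : ∀ m, a m v = 0) (m n : ℤ) : a m (b n v) = 0 := by
  obtain ⟨N, hN⟩ := mutuallyLocal_iff.1 hab
  obtain ⟨K, hK⟩ := hb v
  have hf := subHom_pow_map ((LinearMap.applyₗ v).toAddMonoidHom : Module.End R V →+ V) N
    (commutator a b)
  rw [hN] at hf
  -- Applied to v, the commutator reduces to a(z)b(w)v, which is a Laurent series in w because b is
  -- a field.
  have h0 : (fun m n => a m (b n v)) = 0 := by
    refine eq_zero_of_subHom_pow_eq_zero (N := N) (K := K) ?_ fun m n hn => by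
      rw [hK n hn, map_zero]
    convert hf using 2
    · ext m n
      simp [commutator, h]
    · ext m
      simp
  exact congrFun (congrFun h0 m) n

end Fields

end FormalDistribution

end

/-! ### Goddard uniqueness and the reconstruction theorem. -/

noncomputable section

open FormalDistribution

namespace FormalDistribution

section Linear

variable {R V : Type*} [CommRing R] [AddCommGroup V] [Module R V] {a a' b : ℤ → Module.End R V}

theorem MutuallyLocal.add (h : MutuallyLocal a b) (h' : MutuallyLocal a' b) :
    MutuallyLocal (a + a') b := by
  obtain ⟨N, hN⟩ := mutuallyLocal_iff.1 h
  obtain ⟨N', hN'⟩ := mutuallyLocal_iff.1 h'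
  refine mutuallyLocal_iff.2 ⟨max N N', ?_⟩
  have : commutator (a + a') b = commutator a b + commutator a' b := by
    ext1 m; ext1 n
    simp only [commutator, Pi.add_apply]
    noncomm_ring
  rw [this, map_add, subHom_pow_eq_zero_of_le (le_max_left _ _) hN,
    subHom_pow_eq_zero_of_le (le_max_right _ _) hN', add_zero]

theorem MutuallyLocal.smul (r : R) (h : MutuallyLocal a b) : MutuallyLocal (r • a) b := by
  obtain ⟨N, hN⟩ := mutuallyLocal_iff.1 h
  refine mutuallyLocal_iff.2 ⟨N, ?_⟩
  have h2 := subHom_pow_map (DistribSMul.toAddMonoidHom (Module.End R V) r) N (commutator a b)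
  rw [hN] at h2
  convert h2 using 2
  · ext1 m; ext1 n
    simp [commutator, smul_sub]
  · ext1 m
    simp

theorem mutuallyLocal_zero (b : ℤ → Module.End R V) : MutuallyLocal 0 b :=
  mutuallyLocal_iff.2 ⟨0, by ext1 m; ext1 n; simp [commutator]⟩

end Linear

end FormalDistribution

namespace VertexOperator

variable {R V : Type*} [CommRing R] [AddCommGroup V] [Module R V]

theorem isField_ncoeff (F : VertexOperator R V) : IsField F.ncoeff := fun v =>
  ⟨-HahnSeries.order ((HahnModule.of R).symm (F v)), fun n hn =>
    ncoeff_eq_zero_of_lt_order F n v (by omega)⟩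

theorem ncoeff_injective : Function.Injective (ncoeff : VertexOperator R V → _) := by
  intro F G h
  refine HVertexOperator.coeff_inj (funext fun n => ?_)
  rw [coeff_eq_ncoeff, coeff_eq_ncoeff, h]

/-- The vertex operator with given modes. -/
def ofModes (a : ℤ → Module.End R V) (ha : IsField a) : VertexOperator R V :=
  of_coeff (fun n => a (-n - 1)) fun v => by
    obtain ⟨K, hK⟩ := ha v
    refine ⟨-K, fun n hn => ?_⟩
    by_contra h
    exact hn (hK _ (by omega))

@[simp]
theorem ncoeff_ofModes (a : ℤ → Module.End R V) (ha : IsField a) : (ofModes a ha).ncoeff = a := by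
  ext1 n
  rw [ofModes, ncoeff_of_coeff]
  congr 1
  ring

end VertexOperator

namespace VertexAlgebra

open VertexOperator

variable {V : Type*} [AddCommGroup V] [Module ℂ V]

/-- The translation covariant, creative fields that are local with respect to all fields in `S`. -/
def localFields (vac : V) (T : Module.End ℂ V) (S : Set (VertexOperator ℂ V)) :
    Submodule ℂ (VertexOperator ℂ V) where
  carrier := {F | IsTranslationCovariant T F.ncoeff ∧ IsCreative vac F.ncoeff ∧
    ∀ s ∈ S, MutuallyLocal F.ncoeff s.ncoeff}
  zero_mem' := by
    refine ⟨fun n => ?_, fun n _ => ?_, fun s _ => ?_⟩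
    · simp [FormalDistribution.deriv]
    · simp
    · rw [map_zero]
      exact mutuallyLocal_zero _
  add_mem' := by
    rintro F G ⟨hF, hF', hF''⟩ ⟨hG, hG', hG''⟩
    refine ⟨fun n => ?_, fun n hn => ?_, fun s hs => ?_⟩
    · have h1 := hF n
      have h2 := hG n
      simp only [FormalDistribution.deriv] at h1 h2
      simp only [FormalDistribution.deriv, map_add, Pi.add_apply, smul_add, ← h1, ← h2]
      noncomm_ring
    · simp [hF' n hn, hG' n hn]
    · rw [map_add]
      exact (hF'' s hs).add (hG'' s hs)
  smul_mem' := by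
    rintro r F ⟨hF, hF', hF''⟩
    refine ⟨fun n => ?_, fun n hn => ?_, fun s hs => ?_⟩
    · have h1 := hF n
      simp only [FormalDistribution.deriv] at h1
      simp only [FormalDistribution.deriv, map_smul, Pi.smul_apply, smul_comm _ r, ← h1, smul_sub,
        mul_smul_comm, smul_mul_assoc]
    · simp [hF' n hn]
    · rw [map_smul]
      exact (hF'' s hs).smul r

/-- The map `a(z) ↦ a(z)|0⟩|_{z = 0}` on `localFields`. -/
def fieldState (vac : V) (T : Module.End ℂ V) (S : Set (VertexOperator ℂ V)) :
    localFields vac T S →ₗ[ℂ] V where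
  toFun F := F.1.ncoeff (-1) vac
  map_add' F G := by simp
  map_smul' r F := by simp

variable {vac : V} {T : Module.End ℂ V} {S : Set (VertexOperator ℂ V)}

/-- Goddard's uniqueness theorem. -/
theorem fieldState_injective (hT : T vac = 0)
    (hS : Submodule.span ℂ {v | ∃ l : List (VertexOperator ℂ V × ℤ), (∀ p ∈ l, p.1 ∈ S ∧ p.2 < 0) ∧
      v = (l.map fun p => p.1.ncoeff p.2).prod vac} = ⊤) :
    Function.Injective (fieldState vac T S) := by
  let _ : Module ℚ V := Module.compHom V (algebraMap ℚ ℂ)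
  have : IsAddTorsionFree V := .of_module_rat V
  rw [injective_iff_map_eq_zero]
  rintro ⟨F, hF, hF', hF''⟩ h0
  have hvac (n : ℤ) : F.ncoeff n vac = 0 := apply_vac_eq_zero hT hF hF' h0 n
  have hlist (l : List (VertexOperator ℂ V × ℤ)) (hl : ∀ p ∈ l, p.1 ∈ S ∧ p.2 < 0) (n : ℤ) :
      F.ncoeff n ((l.map fun p => p.1.ncoeff p.2).prod vac) = 0 := by
    induction l generalizing n with
    | nil => simpa using hvac n
    | cons p l ih =>
      rw [List.map_cons, List.prod_cons, Module.End.mul_apply]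
      exact (hF'' p.1 (hl p (by simp)).1).apply_eq_zero (isField_ncoeff _)
        (ih fun q hq => hl q (by simp [hq])) n p.2
  refine Subtype.ext (ncoeff_injective (funext fun n => ?_))
  rw [Submodule.coe_zero, map_zero, Pi.zero_apply]
  refine LinearMap.ext_on hS ?_
  rintro _ ⟨l, hl, rfl⟩
  simpa using hlist l hl n

/-- G is ∂ᵏs; it turns an arbitrary negative mode of s into a mode -1. The locality clause covers
all b, so that it also applies to fields outside S. -/
theorem iterate_deriv_mem {s : VertexOperator ℂ V} (hs : s ∈ localFields vac T S) (k : ℕ) :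
    ∃ G ∈ localFields vac T S, G.ncoeff (-1) = (k.factorial : ℂ) • s.ncoeff (-1 - k) ∧
      ∀ b, MutuallyLocal s.ncoeff b → MutuallyLocal G.ncoeff b := by
  -- The induction needs all negative modes of ∂ᵏs; factorials on both sides avoid division.
  suffices ∃ G ∈ localFields vac T S, (∀ n : ℕ, (n.factorial : ℂ) • G.ncoeff (-1 - n) =
      ((n + k).factorial : ℂ) • s.ncoeff (-1 - (n + k : ℕ))) ∧
      ∀ b, MutuallyLocal s.ncoeff b → MutuallyLocal G.ncoeff b by
    obtain ⟨G, hG, hG', hG''⟩ := this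
    refine ⟨G, hG, ?_, hG''⟩
    simpa using hG' 0
  induction k with
  | zero => exact ⟨s, hs, fun n => rfl, fun b hb => hb⟩
  | succ k ih =>
    obtain ⟨G, ⟨h1, h2, h3⟩, hG', hG''⟩ := ih
    refine ⟨ofModes _ (isField_ncoeff G).deriv, ⟨?_, ?_, fun t ht => ?_⟩, fun n => ?_,
      fun b hb => ?_⟩
    · rw [ncoeff_ofModes]; exact h1.deriv
    · rw [ncoeff_ofModes]; exact h2.deriv
    · rw [ncoeff_ofModes]; exact (h3 t ht).deriv
    · rw [ncoeff_ofModes]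
      have := hG' (n + 1)
      rw [show n + (k + 1) = n + 1 + k by ring, ← this, FormalDistribution.deriv,
        ← Int.cast_smul_eq_zsmul ℂ, smul_smul, Nat.factorial_succ]
      congr 1
      · push_cast; ring
      · exact congrArg _ (by push_cast; ring)
    · rw [ncoeff_ofModes]; exact (hG'' b hb).deriv

/-- A subspace of fields containing the identity and closed under normally ordered products with
derivatives of the generating fields creates all states. -/
theorem exists_mem_ncoeff_neg_one_eq {P : Submodule ℂ (VertexOperator ℂ V)}
    (hcre : ∀ F ∈ P, IsCreative vac F.ncoeff) (hSP : ∀ s ∈ S, s ∈ localFields vac T S)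
    (h1 : ofModes (const 1) (isField_const 1) ∈ P)
    (hP : ∀ s ∈ S, ∀ G ∈ localFields vac T S,
      (∀ b, MutuallyLocal s.ncoeff b → MutuallyLocal G.ncoeff b) → ∀ F ∈ P,
      ofModes _ (isField_normalProd (isField_ncoeff G) (isField_ncoeff F)) ∈ P)
    (hS : Submodule.span ℂ {v | ∃ l : List (VertexOperator ℂ V × ℤ), (∀ p ∈ l, p.1 ∈ S ∧ p.2 < 0) ∧
      v = (l.map fun p => p.1.ncoeff p.2).prod vac} = ⊤) (v : V) :
    ∃ F ∈ P, F.ncoeff (-1) vac = v := by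
  have hlist (l : List (VertexOperator ℂ V × ℤ)) (hl : ∀ p ∈ l, p.1 ∈ S ∧ p.2 < 0) :
      ∃ F ∈ P, F.ncoeff (-1) vac = (l.map fun p => p.1.ncoeff p.2).prod vac := by
    induction l with
    | nil => exact ⟨_, h1, by simp [const]⟩
    | cons p l ih =>
      obtain ⟨F, hF, hFv⟩ := ih fun q hq => hl q (by simp [hq])
      obtain ⟨hp, hp'⟩ := hl p (by simp)
      obtain ⟨k, hk⟩ : ∃ k : ℕ, p.2 = -1 - k := ⟨(-1 - p.2).toNat, by omega⟩
      obtain ⟨G, hG, hG', hG''⟩ := iterate_deriv_mem (hSP p.1 hp) k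
      -- If F creates the tail of the list, then :(∂ᵏs)F: / k! creates s₍₋₁₋ₖ₎ applied to it.
      refine ⟨(k.factorial : ℂ)⁻¹ • _, P.smul_mem _ (hP p.1 hp G hG hG'' F hF), ?_⟩
      rw [map_smul, ncoeff_ofModes, Pi.smul_apply, LinearMap.smul_apply,
        normalProd_neg_one_vac _ _ hG.2.1 (hcre F hF), hG', hFv, LinearMap.smul_apply,
        inv_smul_smul₀ (by exact_mod_cast k.factorial_ne_zero), List.map_cons, List.prod_cons,
        Module.End.mul_apply, hk]
  have hv : v ∈ Submodule.span ℂ {v | ∃ l : List (VertexOperator ℂ V × ℤ),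
      (∀ p ∈ l, p.1 ∈ S ∧ p.2 < 0) ∧ v = (l.map fun p => p.1.ncoeff p.2).prod vac} :=
    hS ▸ Submodule.mem_top
  induction hv using Submodule.span_induction with
  | mem x hx =>
    obtain ⟨l, hl, rfl⟩ := hx
    exact hlist l hl
  | zero => exact ⟨0, P.zero_mem, by simp⟩
  | add x y _ _ hx hy =>
    obtain ⟨F, hF, rfl⟩ := hx
    obtain ⟨G, hG, rfl⟩ := hy
    exact ⟨F + G, P.add_mem hF hG, by simp⟩
  | smul r x _ hx =>
    obtain ⟨F, hF, rfl⟩ := hx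
    exact ⟨r • F, P.smul_mem r hF, by simp⟩

theorem const_one_mem_localFields :
    ofModes (const 1) (isField_const 1) ∈ localFields vac T S := by
  refine ⟨?_, ?_, fun s _ => ?_⟩ <;> rw [ncoeff_ofModes]
  · exact IsTranslationCovariant.const_one T
  · exact isCreative_const vac 1
  · exact mutuallyLocal_const_one _

theorem normalProd_mem_localFields {s : VertexOperator ℂ V} (hs : s ∈ S)
    {G : VertexOperator ℂ V} (hG : G ∈ localFields vac T S)
    (hGs : ∀ b, MutuallyLocal s.ncoeff b → MutuallyLocal G.ncoeff b)
    {F : VertexOperator ℂ V} (hF : F ∈ localFields vac T S) :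
    ofModes _ (isField_normalProd (isField_ncoeff G) (isField_ncoeff F)) ∈
      localFields vac T S := by
  refine ⟨?_, ?_, fun t ht => ?_⟩ <;> rw [ncoeff_ofModes]
  · exact hG.1.normalProd _ _ hF.1
  · exact hG.2.1.normalProd _ _ hF.2.1
  · exact MutuallyLocal.normalProd _ _ (hGs _ (hF.2.2 s hs).symm) (hG.2.2 t ht) (hF.2.2 t ht)

/-- Fields that are local with respect to the generating fields are mutually local. -/
theorem mutuallyLocal_of_mem_localFields (hT : T vac = 0) (hSP : ∀ s ∈ S, s ∈ localFields vac T S)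
    (hS : Submodule.span ℂ {v | ∃ l : List (VertexOperator ℂ V × ℤ), (∀ p ∈ l, p.1 ∈ S ∧ p.2 < 0) ∧
      v = (l.map fun p => p.1.ncoeff p.2).prod vac} = ⊤)
    {F G : VertexOperator ℂ V} (hF : F ∈ localFields vac T S) (hG : G ∈ localFields vac T S) :
    MutuallyLocal F.ncoeff G.ncoeff := by
  -- Fields local to the fixed G already create every state, by Dong's lemma. So some F' in P
  -- creates the same state as F, and uniqueness gives F' = F.
  let P : Submodule ℂ (VertexOperator ℂ V) :=
    { carrier := {F | F ∈ localFields vac T S ∧ MutuallyLocal F.ncoeff G.ncoeff}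
      zero_mem' := ⟨Submodule.zero_mem _, by rw [map_zero]; exact mutuallyLocal_zero _⟩
      add_mem' := fun h h' => ⟨Submodule.add_mem _ h.1 h'.1, by
        rw [map_add]; exact h.2.add h'.2⟩
      smul_mem' := fun r _ h => ⟨Submodule.smul_mem _ r h.1, by
        rw [map_smul]; exact h.2.smul r⟩ }
  obtain ⟨F', hF', h⟩ := exists_mem_ncoeff_neg_one_eq (P := P) (fun F hF => hF.1.2.1) hSP
    ⟨const_one_mem_localFields, by rw [ncoeff_ofModes]; exact mutuallyLocal_const_one _⟩
    (fun s hs H hH hHs E hE => ⟨normalProd_mem_localFields hs hH hHs hE.1, by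
      rw [ncoeff_ofModes]
      exact MutuallyLocal.normalProd _ _ (hHs _ (hE.1.2.2 s hs).symm)
        (hHs _ (hG.2.2 s hs).symm) hE.2⟩) hS (F.ncoeff (-1) vac)
  have : (⟨F', hF'.1⟩ : localFields vac T S) = ⟨F, hF⟩ := fieldState_injective hT hS h
  obtain rfl : F' = F := congrArg Subtype.val this
  exact hF'.2

/-- The existence theorem: mutually local, translation covariant, creative fields whose negative
modes generate `V` from the vacuum give rise to a vertex algebra. -/
theorem exists_of_generating (hT : T vac = 0)
    (hcov : ∀ s ∈ S, IsTranslationCovariant T s.ncoeff)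
    (hcre : ∀ s ∈ S, IsCreative vac s.ncoeff)
    (hloc : ∀ s ∈ S, ∀ t ∈ S, MutuallyLocal s.ncoeff t.ncoeff)
    (hS : Submodule.span ℂ {v | ∃ l : List (VertexOperator ℂ V × ℤ), (∀ p ∈ l, p.1 ∈ S ∧ p.2 < 0) ∧
      v = (l.map fun p => p.1.ncoeff p.2).prod vac} = ⊤) :
    ∃ A : VertexAlgebra V, A.vac = vac ∧ A.T = T ∧ ∀ s ∈ S, A.Y (s.ncoeff (-1) vac) = s := by
  have hSP (s : VertexOperator ℂ V) (hs : s ∈ S) : s ∈ localFields vac T S :=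
    ⟨hcov s hs, hcre s hs, hloc s hs⟩
  have hbij : Function.Bijective (fieldState vac T S) := by
    refine ⟨fieldState_injective hT hS, fun v => ?_⟩
    obtain ⟨F, hF, hv⟩ := exists_mem_ncoeff_neg_one_eq
      (P := localFields vac T S) (fun F hF => hF.2.1) hSP
      const_one_mem_localFields
      (fun s hs G hG hGs F hF => normalProd_mem_localFields hs hG hGs hF) hS v
    exact ⟨⟨F, hF⟩, hv⟩
  let e := LinearEquiv.ofBijective (fieldState vac T S) hbij
  have he (F : VertexOperator ℂ V) (hF : F ∈ localFields vac T S) :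
      (e.symm (F.ncoeff (-1) vac) : VertexOperator ℂ V) = F :=
    congrArg Subtype.val (e.symm_apply_apply ⟨F, hF⟩)
  refine ⟨{ vac := vac, T := T, Y := (localFields vac T S).subtype ∘ₗ e.symm.toLinearMap
            translation := fun a => (e.symm a).2.1
            locality := fun a b =>
              mutuallyLocal_of_mem_localFields hT hSP hS (e.symm a).2 (e.symm b).2
            T_vac := hT
            Y_vac := ?_
            ncoeff_vac := fun a => (e.symm a).2.2.1
            ncoeff_neg_one_vac := fun a => e.apply_symm_apply a }, rfl, rfl,
    fun s hs => he s (hSP s hs)⟩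
  have h := he _ (const_one_mem_localFields (vac := vac) (T := T) (S := S))
  rw [ncoeff_ofModes] at h
  rw [← ncoeff_ofModes (const 1) (isField_const (1 : Module.End ℂ V)), ← h]
  simp [const]

end VertexAlgebra

end

noncomputable section

open FormalDistribution

/-! ### The Sugawara construction for the Heisenberg algebra -/

namespace Heisenberg

/-- `[q < 0] - [m + q < 0]`. -/
def signDefect (m q : ℤ) : ℂ := (if q < 0 then 1 else 0) - (if m + q < 0 then 1 else 0)

theorem signDefect_support (m : ℤ) (g : ℤ → ℂ) :
    (Function.support fun q => g q * signDefect m q).Finite := by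
  refine (Set.finite_Icc (-|m|) |m|).subset fun q hq => ?_
  contrapose! hq
  rw [Function.notMem_support, signDefect]
  rw [Set.mem_Icc, not_and_or, not_le, not_le] at hq
  have h1 := le_abs_self m
  have h2 := neg_abs_le m
  rcases hq with hq | hq
  · rw [if_pos (by omega), if_pos (by omega), sub_self, mul_zero]
  · rw [if_neg (by omega), if_neg (by omega), sub_self, mul_zero]

/-- Raising m by one changes a single value, so sums weighted by `signDefect` are computed by
recursion on m. -/
theorem signDefect_succ (m q : ℤ) :
    signDefect (m + 1) q = signDefect m q + if q = -m - 1 then 1 else 0 := by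
  simp only [signDefect]
  split_ifs <;> first | omega | norm_num

theorem signDefect_zero (q : ℤ) : signDefect 0 q = 0 := by simp [signDefect]

theorem int_eq_of_succ {f g : ℤ → ℂ} (h0 : f 0 = g 0)
    (h : ∀ m, f (m + 1) - f m = g (m + 1) - g m) (m : ℤ) : f m = g m := by
  induction m using Int.induction_on with
  | zero => exact h0
  | succ i ih => linear_combination h i + ih
  | pred i ih =>
    have := h (-(i : ℤ) - 1)
    rw [sub_add_cancel] at this
    linear_combination ih - this

theorem finsum_signDefect_linear (m : ℤ) :
    ∑ᶠ q : ℤ, (-q : ℂ) * signDefect m q = (m * (m + 1) : ℂ) / 2 := by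
  refine int_eq_of_succ (f := fun m => ∑ᶠ q : ℤ, (-q : ℂ) * signDefect m q)
    (g := fun m => (m * (m + 1) : ℂ) / 2) ?_ (fun m => ?_) m
  · simp [signDefect_zero]
  · rw [← finsum_sub_distrib (signDefect_support _ _) (signDefect_support _ _),
      finsum_eq_single _ (-m - 1)]
    · rw [signDefect_succ]
      push_cast
      simp only [if_true]
      ring
    · intro q hq
      rw [signDefect_succ, if_neg hq]
      ring

/-- The source of the central term. The increment in m is the linear sum, because the new entry q =
-m - 1 carries the factor m + 1 + q = 0. -/
theorem finsum_signDefect_quadratic (m : ℤ) :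
    ∑ᶠ q : ℤ, (-q * (m + q) : ℂ) * signDefect m q = (m ^ 3 - m : ℂ) / 6 := by
  refine int_eq_of_succ (f := fun m => ∑ᶠ q : ℤ, (-q * (m + q) : ℂ) * signDefect m q)
    (g := fun m => (m ^ 3 - m : ℂ) / 6) ?_ (fun m => ?_) m
  · simp [signDefect_zero]
  · rw [← finsum_sub_distrib (signDefect_support _ _) (signDefect_support _ _),
      finsum_congr (g := fun q : ℤ => (-q : ℂ) * signDefect m q), finsum_signDefect_linear]
    · push_cast
      ring
    · intro q
      rw [signDefect_succ]
      split_ifs with hq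
      · subst hq
        push_cast
        ring
      · push_cast
        ring

variable {V : Type*} [AddCommGroup V] [Module ℂ V] {a : ℤ → Module.End ℂ V} (ha : IsField a)

/-- The modes `Lₙ = ½ ∑ :aₚ aₙ₋ₚ:`. -/
def sugawara (n : ℤ) : Module.End ℂ V := (2⁻¹ : ℂ) • normalProd ha ha (n + 1)

theorem normalProd_succ_apply (n : ℤ) (v : V) :
    normalProd ha ha (n + 1) v = ∑ᶠ p, normalOrder a a p (n - p) v := by
  rw [normalProd_apply, add_sub_cancel_right]

theorem support_map_finite (f : Module.End ℂ V) {g : ℤ → V} (hg : (Function.support g).Finite) :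
    (Function.support fun p => f (g p)).Finite := by
  refine hg.subset fun p hp => ?_
  contrapose! hp
  rw [Function.notMem_support] at hp ⊢
  rw [hp, map_zero]

theorem support_smul_finite (c : ℤ → ℂ) {g : ℤ → V} (hg : (Function.support g).Finite) :
    (Function.support fun p => c p • g p).Finite := by
  refine hg.subset fun p hp => ?_
  contrapose! hp
  rw [Function.notMem_support] at hp ⊢
  rw [hp, smul_zero]

theorem apply_apply
    (hcomm : ∀ m n, a m * a n - a n * a m = (if m + n = 0 then (m : ℂ) else 0) • 1)
    (m n : ℤ) (v : V) :
    a m (a n v) = a n (a m v) + (if m + n = 0 then (m : ℂ) else 0) • v := by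
  have := LinearMap.congr_fun (hcomm m n) v
  simp only [LinearMap.sub_apply, Module.End.mul_apply, LinearMap.smul_apply,
    Module.End.one_apply] at this
  rw [← this]
  abel

/-- The commutators of the modes are scalars, so the result is the same in either order. -/
theorem normalOrder_apply_comm
    (hcomm : ∀ m n, a m * a n - a n * a m = (if m + n = 0 then (m : ℂ) else 0) • 1)
    (p q n : ℤ) (v : V) :
    normalOrder a a p q (a n v) - a n (normalOrder a a p q v) =
      (if p = -n then (-n : ℂ) else 0) • a q v + (if q = -n then (-n : ℂ) else 0) • a p v := by
  have h (m : ℤ) : (if m + n = 0 then (m : ℂ) else 0) = if m = -n then (-n : ℂ) else 0 := by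
    by_cases hm : m = -n
    · rw [if_pos (by omega), if_pos hm, hm]
      push_cast
      rfl
    · rw [if_neg (by omega), if_neg hm]
  have hp := fun w => h p ▸ apply_apply hcomm p n w
  have hq := fun w => h q ▸ apply_apply hcomm q n w
  by_cases hp0 : p < 0 <;>
    simp only [normalOrder, hp0, if_true, if_false, Module.End.mul_apply, hp, hq, map_add,
      map_smul] <;>
    abel

theorem sugawara_comm
    (hcomm : ∀ m n, a m * a n - a n * a m = (if m + n = 0 then (m : ℂ) else 0) • 1)
    (m n : ℤ) (v : V) :
    sugawara ha m (a n v) = a n (sugawara ha m v) + (-n : ℂ) • a (m + n) v := by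
  have hfin := fun v => normalOrder_support_finite ha ha m v
  suffices normalProd ha ha (m + 1) (a n v) - a n (normalProd ha ha (m + 1) v)
      = (2 : ℂ) • (-n : ℂ) • a (m + n) v by
    rw [sugawara, LinearMap.smul_apply, LinearMap.smul_apply, map_smul,
      sub_eq_iff_eq_add.1 this]
    module
  rw [normalProd_succ_apply, normalProd_succ_apply, map_finsum _ (hfin v),
    ← finsum_sub_distrib (hfin _) (support_map_finite (a n) (hfin v))]
  simp only [normalOrder_apply_comm hcomm]
  -- The terms p = -n and p = m + n contribute equally, which cancels the factor ½.
  rw [finsum_add_distrib, finsum_eq_single _ (-n), finsum_eq_single _ (m + n)]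
  · rw [if_pos rfl, if_pos (by ring), sub_neg_eq_add]
    module
  · intro p hp
    rw [if_neg (by omega), zero_smul]
  · intro p hp
    rw [if_neg (by omega), zero_smul]
  · refine (Set.finite_singleton (-n)).subset fun p hp => ?_
    contrapose! hp
    rw [Function.notMem_support, if_neg (by simpa using hp), zero_smul]
  · refine (Set.finite_singleton (m + n)).subset fun p hp => ?_
    contrapose! hp
    rw [Set.mem_singleton_iff] at hp
    rw [Function.notMem_support, if_neg (by omega), zero_smul]

/-- By the Leibniz rule. The term with a₍ₘ₊q₎ inherits its order from the sign of q instead of m +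
q; restoring normal order costs the scalar [a₍ₘ₊q₎, aᵣ], whose sign `signDefect` records. -/
theorem sugawara_normalOrder
    (hcomm : ∀ m n, a m * a n - a n * a m = (if m + n = 0 then (m : ℂ) else 0) • 1)
    (m q r : ℤ) (v : V) :
    sugawara ha m (normalOrder a a q r v) - normalOrder a a q r (sugawara ha m v) =
      (-q : ℂ) • normalOrder a a (m + q) r v + (-r : ℂ) • normalOrder a a q (m + r) v +
        (if m + q + r = 0 then (-q * (m + q) : ℂ) * signDefect m q else 0) • v := by
  have hX := apply_apply hcomm (m + q) r v
  simp only [normalOrder, signDefect]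
  split_ifs at hX ⊢ <;>
    simp only [Module.End.mul_apply, sugawara_comm ha hcomm, map_add, map_smul, hX,
      Int.cast_add] <;>
    module

theorem sugawara_sugawara
    (hcomm : ∀ m n, a m * a n - a n * a m = (if m + n = 0 then (m : ℂ) else 0) • 1)
    (m n : ℤ) :
    sugawara ha m * sugawara ha n - sugawara ha n * sugawara ha m =
      ((m : ℂ) - n) • sugawara ha (m + n) +
        (if m + n = 0 then ((m : ℂ) ^ 3 - m) / 12 else 0) • 1 := by
  ext v
  have hfin := normalOrder_support_finite ha ha n v
  have hfin' := normalOrder_support_finite ha ha (m + n) v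
  suffices sugawara ha m (normalProd ha ha (n + 1) v) - normalProd ha ha (n + 1) (sugawara ha m v)
      = ((m : ℂ) - n) • normalProd ha ha (m + n + 1) v +
        (if m + n = 0 then ((m : ℂ) ^ 3 - m) / 6 else 0) • v by
    have h2 : ((2⁻¹ : ℂ) • if m + n = 0 then ((m : ℂ) ^ 3 - m) / 6 else 0) =
        if m + n = 0 then ((m : ℂ) ^ 3 - m) / 12 else 0 := by
      split_ifs
      · rw [smul_eq_mul]; ring
      · simp
    rw [← h2, LinearMap.sub_apply, LinearMap.add_apply, Module.End.mul_apply,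
      Module.End.mul_apply, LinearMap.smul_apply, LinearMap.smul_apply, Module.End.one_apply,
      smul_assoc, sugawara, sugawara, sugawara,
      LinearMap.smul_apply (2⁻¹ : ℂ) (normalProd ha ha (n + 1)),
      LinearMap.smul_apply (2⁻¹ : ℂ) (normalProd ha ha (n + 1)), map_smul, ← smul_sub,
      LinearMap.smul_apply (2⁻¹ : ℂ) (normalProd ha ha (m + n + 1)), smul_comm _ (2⁻¹ : ℂ),
      ← smul_add, ← this]
    rfl
  rw [normalProd_succ_apply, normalProd_succ_apply, normalProd_succ_apply, map_finsum _ hfin,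
    ← finsum_sub_distrib (support_map_finite _ hfin) (normalOrder_support_finite ha ha _ _)]
  simp only [sugawara_normalOrder ha hcomm]
  -- With the shift p = q + m the two quadratic terms combine with coefficient (m - p) + (p - n) = m
  -- - n.
  have e1 (q : ℤ) : (-q : ℂ) • normalOrder a a (m + q) (n - q) v =
      (fun p : ℤ => (m - p : ℂ) • normalOrder a a p (m + n - p) v) (q + m) := by
    simp only
    rw [add_comm q m, show m + n - (m + q) = n - q by ring]
    congr 1
    push_cast
    ring
  have e2 (q : ℤ) : (-(n - q : ℤ) : ℂ) • normalOrder a a q (m + (n - q)) v =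
      (q - n : ℂ) • normalOrder a a q (m + n - q) v := by
    rw [add_sub_assoc]
    congr 1
    push_cast
    ring
  have e3 (q : ℤ) : (if m + q + (n - q) = 0 then (-q * (m + q) : ℂ) * signDefect m q else 0) • v =
      ((if m + n = 0 then (1 : ℂ) else 0) * ((-q * (m + q) : ℂ) * signDefect m q)) • v := by
    rw [show m + q + (n - q) = m + n by ring]
    split_ifs <;> simp
  simp only [e1, e2, e3]
  have f1 := support_smul_finite (fun p : ℤ => (m - p : ℂ)) hfin'
  have f2 := support_smul_finite (fun p : ℤ => (p - n : ℂ)) hfin'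
  have f1' := f1.preimage (add_left_injective m).injOn
  have f3 : (Function.support fun q : ℤ =>
      (if m + n = 0 then (1 : ℂ) else 0) * ((-q * (m + q) : ℂ) * signDefect m q)).Finite := by
    refine (signDefect_support m fun q => (-q * (m + q) : ℂ)).subset fun q hq => ?_
    contrapose! hq
    rw [Function.notMem_support] at hq ⊢
    rw [hq, mul_zero]
  have f3' : (Function.support fun q : ℤ =>
      ((if m + n = 0 then (1 : ℂ) else 0) * ((-q * (m + q) : ℂ) * signDefect m q)) • v).Finite := by
    refine f3.subset fun q hq => ?_
    contrapose! hq
    rw [Function.notMem_support] at hq ⊢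
    rw [hq, zero_smul]
  rw [finsum_add_distrib (by
      refine (f1'.union f2).subset fun q hq => ?_
      contrapose! hq
      simp only [Set.mem_union, not_or, Function.notMem_support, Set.mem_preimage] at hq ⊢
      rw [hq.1, hq.2, add_zero]) f3',
    finsum_add_distrib f1' f2, ← finsum_smul' f3, ← mul_finsum' _ _ (signDefect_support m _),
    finsum_signDefect_quadratic, ite_mul, one_mul, zero_mul]
  congr 1
  rw [show (∑ᶠ q : ℤ, (fun p : ℤ => (m - p : ℂ) • normalOrder a a p (m + n - p) v) (q + m)) = _ from
    finsum_comp_equiv (Equiv.addRight m)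
      (f := fun p : ℤ => (m - p : ℂ) • normalOrder a a p (m + n - p) v),
    ← finsum_add_distrib f1 f2, smul_finsum' _ hfin']
  refine finsum_congr fun p => ?_
  module

/-- The modes `Lₙ + l (n + 1) aₙ`, with a background charge `l`, satisfy the Virasoro relations
with central charge `1 - 12 l²`. -/
theorem sugawara_backgroundCharge
    (hcomm : ∀ m n, a m * a n - a n * a m = (if m + n = 0 then (m : ℂ) else 0) • 1)
    (l : ℂ) (m n : ℤ) :
    (sugawara ha m + (l * (m + 1)) • a m) * (sugawara ha n + (l * (n + 1)) • a n) -
      (sugawara ha n + (l * (n + 1)) • a n) * (sugawara ha m + (l * (m + 1)) • a m) =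
    ((m : ℂ) - n) • (sugawara ha (m + n) + (l * ((m + n : ℤ) + 1)) • a (m + n)) +
      ((if m + n = 0 then ((m : ℂ) ^ 3 - m) / 12 else 0) * (1 - 12 * l ^ 2)) • 1 := by
  have h1 := sugawara_sugawara ha hcomm m n
  have h2 (m n : ℤ) : sugawara ha m * a n - a n * sugawara ha m = (-n : ℂ) • a (m + n) := by
    ext v
    simp [sugawara_comm ha hcomm m n v]
  have h3 := h2 m n
  have h4 := h2 n m
  rw [add_comm n m] at h4
  have h5 := hcomm m n
  have expand : (sugawara ha m + (l * (m + 1)) • a m) * (sugawara ha n + (l * (n + 1)) • a n) -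
      (sugawara ha n + (l * (n + 1)) • a n) * (sugawara ha m + (l * (m + 1)) • a m) =
      (sugawara ha m * sugawara ha n - sugawara ha n * sugawara ha m)
      + (l * (n + 1)) • (sugawara ha m * a n - a n * sugawara ha m)
      - (l * (m + 1)) • (sugawara ha n * a m - a m * sugawara ha n)
      + ((l * (m + 1)) * (l * (n + 1))) • (a m * a n - a n * a m) := by
    simp only [add_mul, mul_add, smul_mul_assoc, mul_smul_comm, smul_sub]
    module
  rw [expand, h1, h3, h4, h5]
  -- The linear terms match by m(m + 1) - n(n + 1) = (m - n)(m + n + 1). For n = -m, the square of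
  -- the background term gives l²m(m + 1)(1 - m) = -l²(m³ - m).
  split_ifs with h
  · obtain rfl : n = -m := by omega
    push_cast
    module
  · push_cast
    module

end Heisenberg

/-! ### The Fock space -/

namespace Fock

open MvPolynomial

/-- The Heisenberg modes on the Fock space `ℂ[x₁, x₂, …]`. -/
def mode (n : ℤ) : Module.End ℂ (MvPolynomial ℕ ℂ) :=
  if 0 < n then (n : ℂ) • (pderiv n.toNat).toLinearMap
  -- The variable of index 0 is never touched, since -n > 0.
  else if n < 0 then LinearMap.mulLeft ℂ (X (-n).toNat) else 0

theorem mode_pos {n : ℤ} (hn : 0 < n) (f : MvPolynomial ℕ ℂ) :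
    mode n f = (n : ℂ) • pderiv n.toNat f := by
  rw [mode, if_pos hn]; rfl

theorem mode_neg {n : ℤ} (hn : n < 0) (f : MvPolynomial ℕ ℂ) :
    mode n f = X (-n).toNat * f := by
  rw [mode, if_neg (by omega), if_pos hn]; rfl

theorem mode_zero (f : MvPolynomial ℕ ℂ) : mode 0 f = 0 := by simp [mode]

theorem isField_mode : IsField mode := by
  intro f
  obtain ⟨K, hK⟩ := f.vars.bddAbove
  refine ⟨K + 1, fun n hn => ?_⟩
  rw [mode_pos (by omega), pderiv_eq_zero_of_notMem_vars, smul_zero]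
  intro h
  have := hK h
  omega

theorem pderiv_comm (i j : ℕ) (f : MvPolynomial ℕ ℂ) :
    pderiv i (pderiv j f) = pderiv j (pderiv i f) := by
  have : ⁅pderiv (R := ℂ) i, pderiv (R := ℂ) j⁆ = 0 := by
    ext k
    simp [Derivation.commutator_apply, pderiv_X, Pi.single_apply, apply_ite]
  have := congrArg (fun D => D f) this
  simpa [Derivation.commutator_apply, sub_eq_zero] using this

theorem mode_comm (m n : ℤ) :
    mode m * mode n - mode n * mode m = (if m + n = 0 then (m : ℂ) else 0) • 1 := by
  refine LinearMap.ext fun f => ?_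
  simp only [LinearMap.sub_apply, Module.End.mul_apply, LinearMap.smul_apply,
    Module.End.one_apply]
  rcases lt_trichotomy m 0 with hm | rfl | hm <;> rcases lt_trichotomy n 0 with hn | rfl | hn
  · rw [if_neg (by omega)]
    simp only [mode_neg hm, mode_neg hn, zero_smul]
    ring
  · simp [mode_zero, hm.ne]
  · simp only [mode_neg hm, mode_pos hn, pderiv_mul, pderiv_X, smul_add, mul_smul_comm]
    by_cases h : m + n = 0
    · obtain rfl : m = -n := by omega
      simp
    · rw [Pi.single_eq_of_ne (by omega), if_neg h]
      simp
  · simp [mode_zero, hn.ne]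
  · simp [mode_zero]
  · simp [mode_zero, hn.ne']
  · simp only [mode_neg hn, mode_pos hm, pderiv_mul, pderiv_X, smul_add, mul_smul_comm]
    by_cases h : m + n = 0
    · obtain rfl : m = -n := by omega
      simp
    · rw [Pi.single_eq_of_ne (by omega), if_neg h]
      simp
  · simp [mode_zero, hm.ne']
  · rw [if_neg (by omega)]
    simp only [mode_pos hm, mode_pos hn, zero_smul, Derivation.map_smul,
      pderiv_comm n.toNat m.toNat, smul_comm (n : ℂ), sub_self]

theorem mode_one {n : ℤ} (hn : 0 ≤ n) : mode n 1 = 0 := by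
  rcases hn.eq_or_lt with rfl | hn
  · exact mode_zero 1
  · simp [mode_pos hn]

theorem sugawara_one {n : ℤ} (hn : -1 ≤ n) : Heisenberg.sugawara isField_mode n 1 = 0 := by
  have hcre : IsCreative (1 : MvPolynomial ℕ ℂ) mode := fun _ => mode_one
  have := hcre.normalProd isField_mode isField_mode hcre (n + 1) (by omega)
  rw [Heisenberg.sugawara, LinearMap.smul_apply, this, smul_zero]

/-- The action of `Lₙ` on the Fock space with background charge `l`. -/
def virasoroMode (l : ℂ) (n : ℤ) : Module.End ℂ (MvPolynomial ℕ ℂ) :=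
  Heisenberg.sugawara isField_mode n + (l * (n + 1)) • mode n

/-- The factor n + 1 in the background term is what keeps L₋₁ · 1 = 0. -/
theorem virasoroMode_one (l : ℂ) {n : ℤ} (hn : -1 ≤ n) : virasoroMode l n 1 = 0 := by
  rw [virasoroMode, LinearMap.add_apply, sugawara_one hn, LinearMap.smul_apply, zero_add]
  rcases hn.eq_or_lt with rfl | hn
  · simp
  · rw [mode_one (by omega), smul_zero]

end Fock

/-! ### Nonvanishing of the vacuum vector -/

namespace Virasoro

/-- The linear map `Vir → A` with `Lₙ ↦ ℓ n` and `C ↦ c`. -/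
def repr {A : Type*} [Ring A] [Algebra ℂ A] (ℓ : ℤ → A) (c : ℂ) : Virasoro →ₗ[ℂ] A where
  toFun x := Finsupp.linearCombination ℂ ℓ x.witt + (x.central * c) • 1
  map_add' x y := by simp; module
  map_smul' r x := by simp; module

theorem repr_L {A : Type*} [Ring A] [Algebra ℂ A] (ℓ : ℤ → A) (c : ℂ) (n : ℤ) :
    repr ℓ c (L n) = ℓ n := by
  simp [repr, L]

theorem repr_C {A : Type*} [Ring A] [Algebra ℂ A] (ℓ : ℤ → A) (c : ℂ) :
    repr ℓ c C = c • 1 := by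
  simp [repr, C]

theorem repr_lie {A : Type*} [Ring A] [Algebra ℂ A] {ℓ : ℤ → A} {c : ℂ}
    (h : ∀ m n, ℓ m * ℓ n - ℓ n * ℓ m = ((m : ℂ) - n) • ℓ (m + n) +
      ((if m + n = 0 then ((m : ℂ) ^ 3 - m) / 12 else 0) * c) • 1) (x y : Virasoro) :
    repr ℓ c ⁅x, y⁆ = repr ℓ c x * repr ℓ c y - repr ℓ c y * repr ℓ c x := by
  have key (x y : ℤ →₀ ℂ) : repr ℓ c (wittBracket x y) =
      Finsupp.linearCombination ℂ ℓ x * Finsupp.linearCombination ℂ ℓ y -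
        Finsupp.linearCombination ℂ ℓ y * Finsupp.linearCombination ℂ ℓ x := by
    induction x using Finsupp.induction_linear with
    | zero => simp
    | add x₁ x₂ h₁ h₂ =>
      simp only [map_add, LinearMap.add_apply, h₁, h₂]
      noncomm_ring
    | single m r =>
    induction y using Finsupp.induction_linear with
    | zero => simp
    | add x₁ x₂ h₁ h₂ =>
      simp only [map_add, h₁, h₂]
      noncomm_ring
    | single n s =>
      rw [wittBracket_single, map_smul, basisBracket, map_add, map_smul, map_smul, repr_L, repr_C,
        smul_smul _ c, ← h m n]
      simp only [Finsupp.linearCombination_single, smul_mul_assoc, mul_smul_comm, smul_smul,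
        smul_sub]
      rw [mul_comm r s]
  rw [lie_def, key]
  simp only [repr, LinearMap.coe_mk, AddHom.coe_mk, add_mul, mul_add, smul_mul_assoc,
    mul_smul_comm, one_mul, mul_one]
  module

theorem exists_algHom {A : Type*} [Ring A] [Algebra ℂ A] {ℓ : ℤ → A} {c : ℂ}
    (h : ∀ m n, ℓ m * ℓ n - ℓ n * ℓ m = ((m : ℂ) - n) • ℓ (m + n) +
      ((if m + n = 0 then ((m : ℂ) ^ 3 - m) / 12 else 0) * c) • 1) :
    ∃ φ : U →ₐ[ℂ] A, (∀ n, φ (toU (L n)) = ℓ n) ∧ φ (toU C) = c • 1 := by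
  let _ : LieRing A := LieRing.ofAssociativeRing
  let f : Virasoro →ₗ⁅ℂ⁆ A :=
    { repr ℓ c with map_lie' := fun {x y} => repr_lie h x y }
  refine ⟨UniversalEnvelopingAlgebra.lift ℂ f, fun n => ?_, ?_⟩
  · exact (UniversalEnvelopingAlgebra.lift_ι_apply ℂ f _).trans (repr_L ℓ c n)
  · exact (UniversalEnvelopingAlgebra.lift_ι_apply ℂ f _).trans (repr_C ℓ c)

theorem VacuumModule.v₀_ne_zero (c : ℂ) : VacuumModule.v₀ c ≠ 0 := by
  obtain ⟨l, hl⟩ := IsAlgClosed.exists_pow_nat_eq ((1 - c) / 12) (n := 2) (by norm_num)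
  obtain ⟨φ, hφ, hφC⟩ := exists_algHom (ℓ := Fock.virasoroMode l) (c := c) fun m n => by
    have := Heisenberg.sugawara_backgroundCharge Fock.isField_mode Fock.mode_comm l m n
    rwa [hl, show 1 - 12 * ((1 - c) / 12) = c by ring] at this
  -- The annihilator of the polynomial 1, a left ideal. It contains `vermaIdeal c 0` and U(Vir)L₋₁,
  -- so v₀ = 0 would force 1 to annihilate 1.
  let I : Submodule U U :=
    { carrier := {u | φ u 1 = 0}
      zero_mem' := by simp
      add_mem' := fun {u v} hu hv => by
        rw [Set.mem_ofPred_eq] at hu hv ⊢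
        rw [map_add, LinearMap.add_apply, hu, hv, add_zero]
      smul_mem' := fun r u hu => by
        rw [Set.mem_ofPred_eq] at hu ⊢
        rw [smul_eq_mul, map_mul, Module.End.mul_apply, hu, map_zero] }
  have hI : vermaIdeal c 0 ≤ I := by
    refine Submodule.span_le.2 ?_
    rintro x (⟨n, hn, rfl⟩ | rfl | rfl)
    · change φ _ 1 = 0
      rw [hφ, Fock.virasoroMode_one l (by omega)]
    · change φ _ 1 = 0
      rw [map_zero, sub_zero, hφ, Fock.virasoroMode_one l (by omega)]
    · change φ _ 1 = 0
      rw [map_sub, hφC, AlgHom.commutes, Algebra.algebraMap_eq_smul_one, sub_self]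
      rfl
  intro h0
  rw [VacuumModule.v₀, Submodule.Quotient.mk_eq_zero, Submodule.mem_span_singleton] at h0
  obtain ⟨u, hu⟩ := h0
  rw [Verma.v₀, ← Submodule.Quotient.mk_smul, ← Submodule.Quotient.mk_smul,
    Submodule.Quotient.eq] at hu
  have h1 : φ (u • toU (L (-1)) • (1 : U) - 1) 1 = 0 := hI hu
  rw [map_sub, smul_eq_mul, smul_eq_mul, mul_one, map_mul, hφ, map_one φ, LinearMap.sub_apply,
    Module.End.mul_apply, Fock.virasoroMode_one l le_rfl, map_zero, zero_sub,
    Module.End.one_apply, neg_eq_zero] at h1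
  exact one_ne_zero h1

end Virasoro

end

noncomputable section

open FormalDistribution

/-! ### The structure of the vacuum module -/

namespace Virasoro

/-- A property of elements of `U(Vir)` that holds for scalars and elements of `Vir`, and is closed
under sums and products, holds everywhere. -/
theorem U_induction {P : U → Prop} (halg : ∀ r : ℂ, P (algebraMap ℂ U r))
    (hι : ∀ x, P (toU x)) (hmul : ∀ u v, P u → P v → P (u * v))
    (hadd : ∀ u v, P u → P v → P (u + v)) (u : U) : P u := by
  obtain ⟨t, rfl⟩ : ∃ t, UniversalEnvelopingAlgebra.mkAlgHom ℂ Virasoro t = u :=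
    RingCon.mkₐ_surjective (α := ℂ) (UniversalEnvelopingAlgebra.ringCon ℂ Virasoro) u
  induction t using TensorAlgebra.induction with
  | algebraMap r => rw [AlgHom.commutes]; exact halg r
  | ι x => exact hι x
  | mul a b ha hb => rw [map_mul]; exact hmul _ _ ha hb
  | add a b ha hb => rw [map_add]; exact hadd _ _ ha hb

theorem toU_lie (x y : Virasoro) : toU ⁅x, y⁆ = toU x * toU y - toU y * toU x := by
  let _ : LieRing U := LieRing.ofAssociativeRing
  exact LieHom.map_lie (UniversalEnvelopingAlgebra.ι ℂ) x y

theorem commute_toU_C (u : U) : Commute (toU C) u := by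
  induction u using U_induction with
  | halg r => exact Algebra.commute_algebraMap_right r _
  | hι x =>
    have := toU_lie x C
    rw [lie_C, toU, map_zero, eq_comm, sub_eq_zero] at this
    exact this.symm
  | hmul u v hu hv => exact hu.mul_right hv
  | hadd u v hu hv => exact hu.add_right hv

theorem eq_sum (x : Virasoro) : x = x.witt.sum (fun n r => r • L n) + x.central • C := by
  have hw (f : ℤ →₀ ℂ) : f.sum (fun n r => r • L n) = ⟨f, 0⟩ := by
    induction f using Finsupp.induction_linear with
    | zero => rfl
    | add f g hf hg =>
      rw [Finsupp.sum_add_index' (by simp) (by intros; module), hf, hg]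
      ext <;> simp
    | single n r =>
      rw [Finsupp.sum_single_index (by simp)]
      ext <;> simp [L]
  rw [hw]
  ext <;> simp [C]

namespace VacuumModule

variable {c : ℂ}

theorem mode_apply (n : ℤ) (v : VacuumModule c) : mode c n v = toU (L n) • v := rfl

theorem exists_smul_v₀ (v : VacuumModule c) : ∃ u : U, v = u • v₀ c := by
  obtain ⟨w, rfl⟩ := Submodule.Quotient.mk_surjective _ v
  obtain ⟨u, rfl⟩ := Submodule.Quotient.mk_surjective _ w
  exact ⟨u, congrArg (fun x => Submodule.Quotient.mk (Submodule.Quotient.mk x)) (mul_one u).symm⟩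

theorem smul_v₀_eq_zero {u : U} (hu : u ∈ vermaIdeal c 0) : u • v₀ c = 0 := by
  have h : (Submodule.Quotient.mk (u * 1) : Verma c 0) = 0 :=
    (Submodule.Quotient.mk_eq_zero _).2 (by rwa [mul_one])
  exact congrArg Submodule.Quotient.mk h

theorem toU_C_smul (v : VacuumModule c) : toU C • v = c • v := by
  obtain ⟨u, rfl⟩ := exists_smul_v₀ v
  have h : (toU C - algebraMap ℂ U c) • v₀ c = 0 :=
    smul_v₀_eq_zero (Submodule.subset_span (by simp))
  rw [sub_smul, sub_eq_zero, algebraMap_smul] at h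
  rw [smul_smul, (commute_toU_C u).eq, mul_smul, h, smul_comm]

theorem mode_v₀ {n : ℤ} (hn : -1 ≤ n) : mode c n (v₀ c) = 0 := by
  rw [mode_apply]
  rcases hn.eq_or_lt with rfl | hn
  · rw [v₀, ← Submodule.Quotient.mk_smul, Submodule.Quotient.mk_eq_zero]
    exact Submodule.mem_span_singleton_self _
  · refine smul_v₀_eq_zero (Submodule.subset_span ?_)
    rcases (show 0 ≤ n by omega).eq_or_lt with rfl | hn
    · simp
    · exact Or.inl ⟨n, hn, rfl⟩

theorem mode_mode (m n : ℤ) (v : VacuumModule c) :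
    mode c m (mode c n v) = mode c n (mode c m v) + ((m : ℂ) - n) • mode c (m + n) v +
      ((if m + n = 0 then ((m : ℂ) ^ 3 - m) / 12 else 0) * c) • v := by
  have h := congrArg (fun u : U => u • v) (toU_lie (L m) (L n))
  simp only [lie_L_L, toU, map_add, map_smul (UniversalEnvelopingAlgebra.ι ℂ),
    add_smul _ _ v, sub_smul _ _ v, smul_assoc, mul_smul] at h
  rw [show (UniversalEnvelopingAlgebra.ι ℂ C : U) • v = c • v from toU_C_smul v, smul_smul] at h
  rw [mode_apply, mode_apply, mode_apply, mode_apply, mode_apply, add_assoc, h]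
  abel

theorem mode_mul_sub (m n : ℤ) : mode c m * mode c n - mode c n * mode c m =
    ((m : ℂ) - n) • mode c (m + n) +
      ((if m + n = 0 then ((m : ℂ) ^ 3 - m) / 12 else 0) * c) • 1 := by
  refine LinearMap.ext fun v => ?_
  simp only [LinearMap.sub_apply, LinearMap.add_apply, LinearMap.smul_apply, Module.End.mul_apply,
    Module.End.one_apply, mode_mode m n v]
  abel

/-- A subspace containing `v₀` and stable under all `Lₙ` is everything. -/
theorem eq_top_of_mode_mem {W : Submodule ℂ (VacuumModule c)} (h0 : v₀ c ∈ W)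
    (hW : ∀ n, ∀ v ∈ W, mode c n v ∈ W) : W = ⊤ := by
  have key (u : U) : ∀ v ∈ W, u • v ∈ W := by
    induction u using U_induction with
    | halg r => intro v hv; rw [algebraMap_smul]; exact W.smul_mem r hv
    | hι x =>
      intro v hv
      have hx : toU x = ∑ n ∈ x.witt.support, x.witt n • toU (L n) + x.central • toU C := by
        conv_lhs => rw [eq_sum x]
        simp only [toU, Finsupp.sum, map_add, map_sum, map_smul]
      rw [hx, add_smul, smul_assoc, Finset.sum_smul, toU_C_smul]
      refine W.add_mem (W.sum_mem fun n _ => ?_) (W.smul_mem _ (W.smul_mem _ hv))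
      rw [smul_assoc]
      exact W.smul_mem _ (hW n v hv)
    | hmul u u' hu hu' => intro v hv; rw [mul_smul]; exact hu _ (hu' v hv)
    | hadd u u' hu hu' => intro v hv; rw [add_smul]; exact W.add_mem (hu v hv) (hu' v hv)
  rw [eq_top_iff]
  intro v _
  obtain ⟨u, rfl⟩ := exists_smul_v₀ v
  exact key u _ h0

variable (c) in
theorem isField_mode : IsField (fun n => mode c (n - 1)) := by
  let W : Submodule ℂ (VacuumModule c) :=
    { carrier := {v | ∃ K : ℤ, ∀ n, K ≤ n → mode c n v = 0}
      zero_mem' := ⟨0, fun n _ => map_zero _⟩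
      add_mem' := by
        rintro v w ⟨K, hK⟩ ⟨K', hK'⟩
        exact ⟨max K K', fun n hn => by
          rw [map_add, hK n (by omega), hK' n (by omega), add_zero]⟩
      smul_mem' := by
        rintro r v ⟨K, hK⟩
        exact ⟨K, fun n hn => by rw [map_smul, hK n hn, smul_zero]⟩ }
  have hW : W = ⊤ := by
    refine eq_top_of_mode_mem ⟨-1, fun n hn => mode_v₀ hn⟩ ?_
    rintro k v ⟨K, hK⟩
    -- The bound 1 - k excludes n + k = 0, so no central term appears.
    refine ⟨max K (max (K - k) (1 - k)), fun n hn => ?_⟩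
    rw [mode_mode, hK n (by omega), hK (n + k) (by omega), if_neg (by omega)]
    simp
  intro v
  obtain ⟨K, hK⟩ : v ∈ W := hW ▸ Submodule.mem_top
  exact ⟨K + 1, fun n hn => hK _ (by omega)⟩

/-! ### Spanning monomials and the weight decomposition. -/

variable (c) in
/-- The vector `L_{n₁} ⋯ L_{nₖ} v₀`. -/
def monomial (l : List ℤ) : VacuumModule c := (l.map (mode c)).prod (v₀ c)

theorem monomial_nil : monomial c [] = v₀ c := by simp [monomial]

theorem monomial_cons (n : ℤ) (l : List ℤ) : monomial c (n :: l) = mode c n (monomial c l) := by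
  simp [monomial]

-- Any Lₙ can be commuted to the right: on v₀ it vanishes or has n ≤ -2, and the commutators act on
-- shorter monomials. The induction on length treats all n at once.
variable (c) in
theorem span_monomial :
    Submodule.span ℂ {v | ∃ l : List ℤ, (∀ n ∈ l, n ≤ -2) ∧ v = monomial c l} = ⊤ := by
  set W := Submodule.span ℂ {v | ∃ l : List ℤ, (∀ n ∈ l, n ≤ -2) ∧ v = monomial c l} with hW
  have hmem (l : List ℤ) (hl : ∀ n ∈ l, n ≤ -2) : monomial c l ∈ W :=
    Submodule.subset_span ⟨l, hl, rfl⟩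
  have stable (n : ℤ) (h : ∀ l : List ℤ, (∀ n ∈ l, n ≤ -2) → mode c n (monomial c l) ∈ W) :
      ∀ v ∈ W, mode c n v ∈ W := by
    intro v hv
    have : W ≤ W.comap (mode c n) := by
      rw [hW, Submodule.span_le]
      rintro _ ⟨l, hl, rfl⟩
      exact h l hl
    exact this hv
  have low (n : ℤ) (hn : n ≤ -2) (l : List ℤ) (hl : ∀ n ∈ l, n ≤ -2) :
      mode c n (monomial c l) ∈ W := by
    rw [← monomial_cons]
    exact hmem _ (by simpa [hn] using hl)
  have all (l : List ℤ) (hl : ∀ n ∈ l, n ≤ -2) (n : ℤ) : mode c n (monomial c l) ∈ W := by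
    induction l generalizing n with
    | nil =>
      rcases le_or_gt n (-2) with hn | hn
      · exact low n hn [] (by simp)
      · rw [monomial_nil, mode_v₀ (by omega)]
        exact W.zero_mem
    | cons k l ih =>
      have hl' : ∀ n ∈ l, n ≤ -2 := fun n hn => hl n (by simp [hn])
      rw [monomial_cons, mode_mode]
      refine W.add_mem (W.add_mem ?_ (W.smul_mem _ (ih hl' _))) (W.smul_mem _ (hmem l hl'))
      exact stable k (low k (hl k (by simp))) _ (ih hl' n)
  refine eq_top_of_mode_mem ?_ fun n => stable n fun l hl => all l hl n
  rw [← monomial_nil]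
  exact hmem [] (by simp)

theorem mode_zero_monomial (l : List ℤ) :
    mode c 0 (monomial c l) = (-l.sum : ℂ) • monomial c l := by
  induction l with
  | nil => simp [monomial_nil, mode_v₀]
  | cons k l ih =>
    rw [monomial_cons, mode_mode, ih]
    simp
    module

variable (c) in
/-- The span of the monomials in the `Lₙ`, `n ≤ -2`, of weight `k`. -/
def weightSpan (k : ℤ) : Submodule ℂ (VacuumModule c) :=
  Submodule.span ℂ (monomial c '' {l | (∀ n ∈ l, n ≤ -2) ∧ l.sum = -k})

theorem list_sum_nonpos {l : List ℤ} (hl : ∀ n ∈ l, n ≤ -2) : l.sum ≤ 0 := by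
  induction l with
  | nil => simp
  | cons k l ih =>
    have := ih fun n hn => hl n (by simp [hn])
    have := hl k (by simp)
    rw [List.sum_cons]
    omega

/-- The head of a nonempty list lies in [-k, -2], and removing it lowers the weight. -/
theorem finite_list_sum_eq (k : ℤ) :
    {l : List ℤ | (∀ n ∈ l, n ≤ -2) ∧ l.sum = -k}.Finite := by
  induction hd : k.toNat using Nat.strong_induction_on generalizing k with
  | _ d ih =>
    have hsub : {l : List ℤ | (∀ n ∈ l, n ≤ -2) ∧ l.sum = -k} ⊆
        {[]} ∪ ⋃ n ∈ Set.Icc (-k) (-2),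
          (List.cons n) '' {l : List ℤ | (∀ n ∈ l, n ≤ -2) ∧ l.sum = -(k + n)} := by
      rintro (_ | ⟨n, l⟩) ⟨hl, hs⟩
      · simp
      · have hn := hl n (by simp)
        have hl' : ∀ n ∈ l, n ≤ -2 := fun m hm => hl m (by simp [hm])
        have := list_sum_nonpos hl'
        rw [List.sum_cons] at hs
        refine Or.inr (Set.mem_biUnion (x := n) ⟨by omega, hn⟩ ⟨l, ⟨hl', by omega⟩, rfl⟩)
    refine ((Set.finite_singleton _).union
      ((Set.finite_Icc _ _).biUnion fun n hn => Set.Finite.image _ ?_)).subset hsub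
    have h1 := hn.1
    have h2 := hn.2
    exact ih (k + n).toNat (by omega) _ rfl

theorem weightSpan_le (k : ℤ) : weightSpan c k ≤ (mode c 0).eigenspace (k : ℂ) := by
  rw [weightSpan, Submodule.span_le]
  rintro _ ⟨l, ⟨-, hl⟩, rfl⟩
  rw [SetLike.mem_coe, Module.End.mem_eigenspace_iff, mode_zero_monomial]
  congr 1
  rw [hl, Int.cast_neg, neg_neg]

variable (c) in
theorem iSup_weightSpan : ⨆ k, weightSpan c k = ⊤ := by
  rw [eq_top_iff, ← span_monomial c, Submodule.span_le]
  rintro _ ⟨l, hl, rfl⟩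
  refine Submodule.mem_iSup_of_mem (-l.sum) (Submodule.subset_span ⟨l, ⟨hl, by simp⟩, rfl⟩)

variable (c) in
theorem iSupIndep_eigenspace :
    iSupIndep fun k : ℤ => (mode c 0).eigenspace (k : ℂ) :=
  (mode c 0).eigenspaces_iSupIndep.comp Int.cast_injective

/-- The spans lie in independent eigenspaces and together exhaust V, so no eigenspace can be larger.
-/
theorem weightSpan_eq (k : ℤ) : weightSpan c k = (mode c 0).eigenspace (k : ℂ) :=
  congrFun (((iSupIndep_eigenspace c).le_iff_eq_of_iSup_eq_top (iSup_weightSpan c)).1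
    weightSpan_le) k

theorem finite_weightSpan (k : ℤ) : Module.Finite ℂ (weightSpan c k) :=
  Module.Finite.span_of_finite ℂ ((finite_list_sum_eq k).image _)

theorem weightSpan_neg {k : ℤ} (hk : k < 0) : weightSpan c k = ⊥ := by
  rw [weightSpan, Submodule.span_eq_bot]
  rintro _ ⟨l, ⟨hl, hs⟩, -⟩
  have := list_sum_nonpos hl
  omega

theorem weightSpan_zero : weightSpan c 0 = Submodule.span ℂ {v₀ c} := by
  have : {l : List ℤ | (∀ n ∈ l, n ≤ -2) ∧ l.sum = -0} = {[]} := by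
    ext l
    refine ⟨?_, by rintro rfl; simp⟩
    rintro ⟨hl, hs⟩
    rcases l with _ | ⟨n, l⟩
    · rfl
    · have := list_sum_nonpos fun m hm => hl m (List.mem_cons_of_mem n hm)
      have := hl n (by simp)
      rw [List.sum_cons] at hs
      omega
  rw [weightSpan, this, Set.image_singleton, monomial_nil]

/-! ### The Virasoro field -/

variable (c) in
/-- The field `L(z) = ∑ₙ Lₙ z⁻ⁿ⁻²`. -/
def field : VertexOperator ℂ (VacuumModule c) := VertexOperator.ofModes _ (isField_mode c)

theorem ncoeff_field (n : ℤ) : (field c).ncoeff n = mode c (n - 1) := by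
  rw [field, VertexOperator.ncoeff_ofModes]

theorem commutator_field (m n : ℤ) :
    commutator (field c).ncoeff (field c).ncoeff m n =
      ((m : ℂ) - n) • mode c (m + n - 2) +
        ((if m + n = 2 then (m * (m - 1) * (m - 2) : ℂ) / 12 else 0) * c) • 1 := by
  rw [FormalDistribution.commutator, ncoeff_field, ncoeff_field, mode_mul_sub,
    show m - 1 + (n - 1) = m + n - 2 by ring]
  congr 2
  · push_cast; ring
  · congr 1
    by_cases h : m + n = 2
    · rw [if_pos h, if_pos (by omega)]
      push_cast
      ring
    · rw [if_neg h, if_neg (by omega)]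

/-- `mulSub` is a first difference in m along lines of constant m + n. There the commutator is
polynomial of degree at most 3 in m, so the fourth difference vanishes. -/
theorem mutuallyLocal_field : MutuallyLocal (field c).ncoeff (field c).ncoeff := by
  refine ⟨4, ?_⟩
  ext1 m; ext1 n
  simp only [Function.iterate_succ, Function.iterate_zero, Function.comp_apply, id_eq, mulSub,
    commutator_field, Pi.zero_apply]
  ring_nf
  split_ifs
  · push_cast
    module
  · push_cast
    module

theorem isTranslationCovariant_field :
    IsTranslationCovariant (mode c (-1)) (field c).ncoeff := by
  intro n
  rw [FormalDistribution.deriv, ncoeff_field, ncoeff_field, mode_mul_sub,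
    show -1 + (n - 1) = n - 1 - 1 by ring, ← Int.cast_smul_eq_zsmul ℂ]
  push_cast
  norm_num
  module

theorem isCreative_field : IsCreative (v₀ c) (field c).ncoeff := by
  intro n hn
  rw [ncoeff_field, mode_v₀ (by omega)]

/-- Converts the fourth order pole (c/2)·(m choose 3) into the central term m(m - 1)(m - 2)c/12. -/
theorem six_mul_choose_three (m : ℤ) : 6 * Ring.choose m 3 = m * (m - 1) * (m - 2) := by
  have h := Ring.descPochhammer_eq_factorial_smul_choose m 3
  rw [show Nat.factorial 3 = 6 from rfl, nsmul_eq_mul] at h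
  push_cast at h
  rw [← h, ← Polynomial.eval_eq_smeval]
  simp [descPochhammer_succ_left]
  ring

variable (c) in
theorem isVirasoroField_field : IsVirasoroField c (field c) := by
  -- The commutator form of the OPE: the first two terms give 2m - (m + n) = m - n.
  have key (m n : ℤ) : (field c).ncoeff m * (field c).ncoeff n -
      (field c).ncoeff n * (field c).ncoeff m =
      ∑ j : Fin 4, Ring.choose m (j : ℕ) • (![FormalDistribution.deriv (field c).ncoeff,
        (2 : ℂ) • (field c).ncoeff, 0, const ((c / 2) • (1 : Module.End ℂ (VacuumModule c)))]
        : Fin 4 → ℤ → Module.End ℂ (VacuumModule c)) j (m + n - (j : ℕ)) := by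
    have h3 := congrArg (Int.cast : ℤ → ℂ) (six_mul_choose_three m)
    push_cast at h3
    refine (commutator_field m n).trans ?_
    rw [Fin.sum_univ_four]
    simp only [Matrix.cons_val, Fin.coe_ofNat_eq_mod,
      Nat.reduceMod, Ring.choose_zero_right, Ring.choose_one_right,
      FormalDistribution.deriv, Pi.smul_apply, Pi.zero_apply, smul_zero, const, ncoeff_field,
      ← Int.cast_smul_eq_zsmul ℂ]
    push_cast
    rw [show m + n - 0 - 1 - 1 = m + n - 2 by ring, show m + n - 1 - 1 = m + n - 2 by ring]
    by_cases h : m + n = 2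
    · rw [if_pos h, if_pos (by omega), ← h3]
      module
    · rw [if_neg h, if_neg (by omega)]
      module
  refine ⟨fun m n => ?_, fun m n => ?_⟩
  -- For each sign of m one pole expansion vanishes and its identity is the definition of normal
  -- order; the other identity is `key`.
  · rcases lt_or_ge m 0 with hm | hm
    · simp [poleZW, normalOrder, hm, hm.not_ge]
    · simp only [poleZW, normalOrder, hm, hm.not_gt, if_true, if_false, ← key]
      abel
  · rcases lt_or_ge m 0 with hm | hm
    · simp only [poleWZ, normalOrder, hm, if_true, Finset.sum_neg_distrib, ← key]
      abel
    · simp [poleWZ, normalOrder, hm.not_gt]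

variable (c) in
theorem span_field : Submodule.span ℂ {v | ∃ l : List (VertexOperator ℂ (VacuumModule c) × ℤ),
    (∀ p ∈ l, p.1 ∈ ({field c} : Set (VertexOperator ℂ (VacuumModule c))) ∧ p.2 < 0) ∧
      v = (l.map fun p => p.1.ncoeff p.2).prod (v₀ c)} = ⊤ := by
  rw [eq_top_iff, ← span_monomial c]
  refine Submodule.span_mono ?_
  rintro _ ⟨l, hl, rfl⟩
  -- L₍ₙ₊₁₎ = Lₙ, and n ≤ -2 means n + 1 < 0.
  refine ⟨l.map fun n => (field c, n + 1), ?_, ?_⟩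
  · intro p hp
    obtain ⟨n, hn, rfl⟩ := List.mem_map.1 hp
    exact ⟨rfl, by have := hl n hn; simp only; omega⟩
  · rw [monomial, List.map_map]
    congr 3
    ext1 n
    rw [Function.comp_apply, ncoeff_field, add_sub_cancel_right]

end VacuumModule

end Virasoro

end

/-! ### The vertex operator algebra structure on the vacuum module. -/

open Virasoro in
theorem mainTheorem6 (c : ℂ) :
    ∃ A : VertexAlgebra (VacuumModule c),
      A.vac = VacuumModule.v₀ c ∧
      A.T = VacuumModule.mode c (-1) ∧
      A.IsCFTType c (VacuumModule.ν c) ∧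
      (∀ n : ℤ, A.Lmode (VacuumModule.ν c) n = VacuumModule.mode c n) ∧
      A.IsStronglyGeneratedBy {A.Y (VacuumModule.ν c)} := by
  obtain ⟨A, hvac, hT, hY⟩ := VertexAlgebra.exists_of_generating
    (S := {VacuumModule.field c}) (VacuumModule.mode_v₀ (c := c) le_rfl)
    (by rintro _ rfl; exact VacuumModule.isTranslationCovariant_field)
    (by rintro _ rfl; exact VacuumModule.isCreative_field)
    (by rintro _ rfl _ rfl; exact VacuumModule.mutuallyLocal_field)
    (VacuumModule.span_field c)
  -- The state of L(z) is L₍₋₁₎v₀ = L₋₂v₀ = ν.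
  have hν : A.Y (VacuumModule.ν c) = VacuumModule.field c := by
    have := hY _ rfl
    rwa [VacuumModule.ncoeff_field] at this
  have hL (n : ℤ) : A.Lmode (VacuumModule.ν c) n = VacuumModule.mode c n := by
    rw [VertexAlgebra.Lmode, hν, VacuumModule.ncoeff_field, add_sub_cancel_right]
  have hhom (n : ℤ) : A.homogeneous (VacuumModule.ν c) n = VacuumModule.weightSpan c n := by
    rw [VertexAlgebra.homogeneous, hL, VacuumModule.weightSpan_eq]
  have hsup : ⨆ n : ℤ, A.homogeneous (VacuumModule.ν c) n = ⊤ := by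
    simp only [hhom, VacuumModule.iSup_weightSpan]
  refine ⟨A, hvac, hT, ?_, hL, ?_⟩
  · refine { virasoro := ?_, L_neg_one := ?_, diagonalizable := ?_, isInternal := ?_,
             bounded_below := ?_, finite := ?_, homogeneous_neg := ?_, homogeneous_zero := ?_,
             vac_ne_zero := ?_ }
    · rw [hν]
      exact VacuumModule.isVirasoroField_field c
    · rw [hL, hT]
    -- The eigenspaces for integer eigenvalues already exhaust V.
    · exact eq_top_iff.2 (hsup.ge.trans (iSup_le fun n => le_iSup_of_le (n : ℂ) le_rfl))
    · refine DirectSum.isInternal_submodule_of_iSupIndep_of_iSup_eq_top ?_ hsup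
      rw [show A.homogeneous (VacuumModule.ν c) = _ from
        funext fun n => (hhom n).trans (VacuumModule.weightSpan_eq n)]
      exact VacuumModule.iSupIndep_eigenspace c
    · exact ⟨0, fun n hn => by rw [hhom, VacuumModule.weightSpan_neg hn]⟩
    · intro n
      rw [hhom]
      exact VacuumModule.finite_weightSpan n
    · intro n hn
      rw [hhom, VacuumModule.weightSpan_neg hn]
    · rw [hhom, hvac, VacuumModule.weightSpan_zero]
    · rw [hvac]
      exact VacuumModule.v₀_ne_zero c
  · refine ⟨by rintro _ rfl; exact ⟨_, rfl⟩, ?_⟩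
    rw [hν, hvac]
    exact VacuumModule.span_field c
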